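/- Let $q\ge 5$ be a prime, put $q^*=(-1)^{(q-1)/2}q$ and let $u_q(j)=\bigl(3^j-q^*(-1)^j\bigr)/4$ for $j\ge 1$ (these are integers). For $n\ge 1$ let $D_q(n)$ be the least positive integer $m$ such that $u_q(1),\dots,u_q(n)$ are pairwise incongruent modulo $m$. Call the prime $q$ *Artin* if $3$ is a primitive root modulo $q$, *Fermat* if $q=2^m+1$ for some $m\ge 1$, and *Mirimanoff* if $3^{q-1}\equiv 1\pmod{q^2}$. (1) If $q\equiv\pm1\pmod{28}$, then $D_q(5)=7$. For every other pair $(q,n)$, that is, for every $n\ge1$ except for $n=5$ when $q\equiv \pm1\pmod{28}$, $$D_q(n)=\begin{cases} \min\{2^e,\,q^f : 2^e\ge n,\ q^f\ge \frac{q}{q-1}n\} & \text{if } q \text{ is Artin but not Mirimanoff},\\ \min\{2^e,\,q : 2^e\ge n,\ q\ge n+1\} & \text{if } q \text{ is Artin and Mirimanoff but not Fermat},\\ \min\{2^e : 2^e\ge n\} & \text{if } q \text{ is Artin, Mirimanoff and Fermat},\\ \min\{2^e : 2^e\ge n\} & \text{if } q \text{ is not Artin}. \end{cases}$$ Here $e$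 and $f$ run over the non-negative integers, and each minimum is over those of the listed numbers that satisfy the stated inequality (so in the second case $q$ is a candidate only when $q\ge n+1$). (2) Every power $2^e$ with $e\ge0$ occurs as a value, that is, lies in $\mathcal D_q=\{D_q(n):n\ge1\}$. For $f\ge1$ the following holds. If $q$ is Artin but not Mirimanoff, then $q^f\in\mathcal D_q$ if and only if $$\Big\{f\,\frac{\log q}{\log 2}\Big\}>\frac{\log (q/(q-1))}{\log 2},$$ where $\{x\}$ is the fractional part of $x$. If $q$ is Artin and Mirimanoff but not Fermat, then $q^f\in\mathcal D_q$ if and only if $f=1$. In the two remaining cases $q^f\notin\mathcal D_q$. (3) In particular, if $q$ is Artin and $n\ge1$, $n\ne5$, then $D_q(n)$ is a power of $2$ or a power of $q$ (Browkin's conjecture for $n\neq 5$). -/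

import Mathlib

/-- `v 1, …, v n` are pairwise incongruent modulo `m`. -/
def Discriminates (v : ℕ → ℤ) (n m : ℕ) : Prop :=
  ∀ i j : ℕ, 1 ≤ i → i < j → j ≤ n → ¬ v i ≡ v j [ZMOD (m : ℤ)]

/-- The discriminator of the first `n` terms of `v`: the least positive integer `m` such that
`v 1, …, v n` are pairwise incongruent modulo `m`. -/
noncomputable def discriminator (v : ℕ → ℤ) (n : ℕ) : ℕ :=
  sInf {m : ℕ | 0 < m ∧ Discriminates v n m}

/-- `q* = (-1)^((q-1)/2) q`. -/
def qStar (q : ℕ) : ℤ := (-1) ^ ((q - 1) / 2) * (q : ℤ)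

/-- The Browkin–Sălăjan sequence `u_q(j) = (3^j - q* (-1)^j) / 4`, for odd `q`; the division is
exact, see `four_mul_browkinSalajan`. -/
def browkinSalajan (q j : ℕ) : ℤ := (3 ^ j - qStar q * (-1) ^ j) / 4

/-- `D_q(n)`. -/
noncomputable def browkinD (q n : ℕ) : ℕ := discriminator (browkinSalajan q) n

/-- The set `{D_q(n) : n ≥ 1}`. -/
def browkinValues (q : ℕ) : Set ℕ := {m | ∃ n : ℕ, 1 ≤ n ∧ browkinD q n = m}

/-- `q` is a prime for which `3` is a primitive root modulo `q`. -/
def IsArtinPrime (q : ℕ) : Prop := q.Prime ∧ IsPrimitiveRoot (3 : ZMod q) (q - 1)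

/-- `q` is a prime of the form `2^m + 1` with `m ≥ 1`. -/
def IsFermatPrime (q : ℕ) : Prop := q.Prime ∧ ∃ m : ℕ, 1 ≤ m ∧ q = 2 ^ m + 1

/-- `q` is a prime with `3^(q-1) ≡ 1 (mod q²)`. -/
def IsMirimanoffPrime (q : ℕ) : Prop := q.Prime ∧ 3 ^ (q - 1) ≡ 1 [MOD q ^ 2]

theorem qStar_emod_four {q : ℕ} (hq : Odd q) : qStar q % 4 = 1 := by
  obtain ⟨k, rfl⟩ := hq
  have h : (2 * k + 1 - 1) / 2 = k := by omega
  rw [qStar, h]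
  rcases Nat.even_or_odd k with ⟨l, hl⟩ | ⟨l, hl⟩
  · rw [Even.neg_one_pow ⟨l, hl⟩]; push_cast; omega
  · rw [Odd.neg_one_pow ⟨l, hl⟩]; push_cast; omega

theorem four_mul_browkinSalajan {q : ℕ} (hq : Odd q) (j : ℕ) :
    4 * browkinSalajan q j = 3 ^ j - qStar q * (-1) ^ j := by
  have h3 : (3 : ℤ) ^ j ≡ (-1) ^ j [ZMOD 4] := Int.ModEq.pow j (by decide)
  have hs : qStar q ≡ 1 [ZMOD 4] := qStar_emod_four hq
  have h : (3 : ℤ) ^ j ≡ qStar q * (-1) ^ j [ZMOD 4] := by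
    simpa using h3.trans (by simpa using (hs.mul_right ((-1) ^ j)).symm)
  exact Int.mul_ediv_cancel' h.symm.dvd

/-- If `v 1, …, v n` are distinct, the least modulus in the definition of the discriminator
exists. -/
theorem discriminator_isLeast (v : ℕ → ℤ) (n : ℕ) (hv : Set.InjOn v (Set.Icc 1 n)) :
    IsLeast {m : ℕ | 0 < m ∧ Discriminates v n m} (discriminator v n) := by
  have hne : {m : ℕ | 0 < m ∧ Discriminates v n m}.Nonempty := by
    refine ⟨(∑ i ∈ Finset.Icc 1 n, (v i).natAbs) * 2 + 1, by omega, ?_⟩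
    intro i j hi hij hj hc
    have hle : ∀ k ∈ Finset.Icc 1 n,
        (v k).natAbs ≤ ∑ i ∈ Finset.Icc 1 n, (v i).natAbs := fun k hk =>
      Finset.single_le_sum (f := fun i => (v i).natAbs) (fun _ _ => Nat.zero_le _) hk
    have h1 := hle i (Finset.mem_Icc.2 ⟨hi, by omega⟩)
    have h2 := hle j (Finset.mem_Icc.2 ⟨by omega, hj⟩)
    have h0 : v j - v i = 0 :=
      Int.eq_zero_of_abs_lt_dvd hc.dvd (by
        generalize ∑ i ∈ Finset.Icc 1 n, (v i).natAbs = s at h1 h2 ⊢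
        rw [abs_lt]
        omega)
    have := hv ⟨hi, by omega⟩ ⟨by omega, hj⟩ (sub_eq_zero.1 h0).symm
    omega
  exact ⟨Nat.sInf_mem hne, fun m hm => Nat.sInf_le hm⟩

/-!
Let `2 ^ e` be the least power of `2` that is at least `n`. The first `2 ^ e` terms are distinct
modulo `2 ^ e` (`discriminates_two_pow`), so that `D_q(n) ≤ 2 ^ e < 2 n`, and it remains to find the
moduli `m < 2 ^ e` that separate the first `n` terms (`Discriminates.classification`).

Since `4 u_q(j) = 3 ^ j - q* (-1) ^ j`, an even `P` with `3 ^ P ≡ 1` modulo `4 m` is a period modulo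
`m`, so `n ≤ P` unless `3` divides `m`. If `m` is neither a power of `2` nor of a prime `p ≥ 5`,
then some such period is at most `m / 2 < n`, as the exponents belonging to coprime factors of `m`
are all even; multiples of `3` have a short period after a preperiod
(`Discriminates.exists_prime_pow`). So `m = p ^ b`, and the order of `9` modulo `p` is
`(p - 1) / 2` (`Discriminates.isPrimitiveRoot_nine`). Indices `i` even and `j` odd give congruent
terms exactly when `3 ^ i - 3 ^ j ≡ 2 q*` modulo `m`.

* For `p ≠ q` and `b ≥ 2` such a pair exists modulo `p`, because every non-zero residue is
  `x ^ 2 - 3 y ^ 2` with non-zero `x` and `y`. The indices up to `n` that are congruent to `i` or to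
  `j` modulo `p - 1` all give terms in one residue class modulo `p`, and there are more than
  `p ^ (b - 1)` of them, so that two of the terms agree modulo `p ^ b`
  (`Discriminates.not_dvd_of_higher_pow`).
* For `p ≠ q` and `b = 1` every non-zero `d` has to be written as `3 ^ i - 3 ^ j` with `i`, `j` at
  most `n`, where `n` is only known to exceed `p / 2` (`exists_pow_nine_sub`). For `p > 2 ^ 11` this
  follows from a variance estimate for the number of solutions of `x₁ y₁ - x₂ y₂ = d` with `x ∈ P`
  and `y ∈ L` (`exists_bilinear_eq`), applied to sets of powers of `3` whose products stay among the
  first `n` powers. The smaller primes are checked by computation. The only failure is `p = 7`,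
  `d = 2`, `n = 5`, which is the exceptional case `q* ≡ 1` modulo `7`.
* For `p = q` a collision of an even and an odd index appears as soon as `3` is a square modulo `q`,
  so `3` is a primitive root modulo `q`. The periods `(q - 1) q ^ (b - 1)` and, when
  `3 ^ (q - 1) ≡ 1` modulo `q ^ 2`, also `(q - 1) q ^ (b - 2)`, bound `n`. Conversely lifting the
  exponent shows that `q ^ b` separates the first `(q - 1) q ^ (b - 1)` terms if `b = 1` or
  `3 ^ (q - 1)` is not `1` modulo `q ^ 2` (`discriminates_prime_pow`).

The list of values follows by comparing `(q - 1) q ^ (b - 1)`, which is even and hence not `5`, with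
the largest power of `2` below `q ^ b`.
-/

/-! ### Solutions of `x₁ y₁ - x₂ y₂ = d` with `x`, `y` in given sets -/

section Bilinear

variable {F : Type*} [Field F] [Fintype F] [DecidableEq F]

/-- A line of the affine plane over a finite field not through the origin has as many points as
the field. -/
theorem card_filter_bilinear_eq {y : F × F} (hy : y ≠ 0) (d : F) :
    (Finset.univ.filter fun x : F × F => x.1 * y.1 - x.2 * y.2 = d).card = Fintype.card F := by
  rw [← Finset.card_univ]
  by_cases h1 : y.1 = 0
  · have h2 : y.2 ≠ 0 := fun h2 => hy (Prod.ext h1 h2)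
    symm
    refine Finset.card_bij (fun t _ => (t, (t * y.1 - d) / y.2)) ?_ ?_ ?_
    · intro t _
      simp only [Finset.mem_filter_univ]
      field_simp
      ring
    · intro s _ t _ h
      exact (Prod.ext_iff.1 h).1
    · intro x hx
      rw [Finset.mem_filter_univ] at hx
      refine ⟨x.1, Finset.mem_univ _, Prod.ext rfl ?_⟩
      simp only
      rw [← hx]
      field_simp
      ring
  · symm
    refine Finset.card_bij (fun t _ => ((d + t * y.2) / y.1, t)) ?_ ?_ ?_
    · intro t _
      simp only [Finset.mem_filter_univ]
      field_simp
      ring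
    · intro s _ t _ h
      exact (Prod.ext_iff.1 h).2
    · intro x hx
      rw [Finset.mem_filter_univ] at hx
      refine ⟨x.2, Finset.mem_univ _, Prod.ext ?_ rfl⟩
      simp only
      rw [← hx]
      field_simp
      ring

/-- Two distinct lines of the affine plane meet in at most one point. -/
theorem card_filter_bilinear_eq_and_eq_le_one {y z : F × F} (hyz : y ≠ z) {d : F} (hd : d ≠ 0) :
    (Finset.univ.filter fun x : F × F =>
      x.1 * y.1 - x.2 * y.2 = d ∧ x.1 * z.1 - x.2 * z.2 = d).card ≤ 1 := by
  rw [Finset.card_le_one]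
  intro a ha b hb
  rw [Finset.mem_filter_univ] at ha hb
  obtain ⟨ha1, ha2⟩ := ha
  obtain ⟨hb1, hb2⟩ := hb
  by_cases h : y.1 * z.2 - y.2 * z.1 = 0
  · refine absurd (Prod.ext ?_ ?_) hyz
    · have : d * (z.1 - y.1) = 0 := by linear_combination a.2 * h - z.1 * ha1 + y.1 * ha2
      have := (mul_eq_zero.1 this).resolve_left hd
      linear_combination -this
    · have : d * (z.2 - y.2) = 0 := by linear_combination a.1 * h - z.2 * ha1 + y.2 * ha2
      have := (mul_eq_zero.1 this).resolve_left hd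
      linear_combination -this
  · refine Prod.ext ?_ ?_
    · have : (a.1 - b.1) * (y.1 * z.2 - y.2 * z.1) = 0 := by
        linear_combination z.2 * (ha1 - hb1) - y.2 * (ha2 - hb2)
      exact sub_eq_zero.1 ((mul_eq_zero.1 this).resolve_right h)
    · have : (a.2 - b.2) * (y.1 * z.2 - y.2 * z.1) = 0 := by
        linear_combination z.1 * (ha1 - hb1) - y.1 * (ha2 - hb2)
      exact sub_eq_zero.1 ((mul_eq_zero.1 this).resolve_right h)

/-- The equation `x₁ y₁ - x₂ y₂ = d` has a solution with `x ∈ P` and `y ∈ L` as soon as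
`|P| |L|` exceeds the cube of the order of the field. The reason is that the number of `y ∈ L`
with `x₁ y₁ - x₂ y₂ = d` has a small variance as `x` runs over the plane, because two distinct
lines meet in at most one point. -/
theorem exists_bilinear_eq (P L : Finset (F × F)) (hL : ∀ y ∈ L, y ≠ 0) {d : F} (hd : d ≠ 0)
    (h : Fintype.card F ^ 3 < P.card * L.card) :
    ∃ x ∈ P, ∃ y ∈ L, x.1 * y.1 - x.2 * y.2 = d := by
  by_contra! hno
  set N : ℤ := (Fintype.card F : ℤ) with hN
  have hN0 : 0 < N := by
    rw [hN]
    exact_mod_cast Fintype.card_pos (α := F)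
  let f : F × F → ℤ := fun x => ∑ y ∈ L, if x.1 * y.1 - x.2 * y.2 = d then 1 else 0
  have hf1 : ∑ x, f x = N * L.card := by
    rw [Finset.sum_comm, Finset.sum_congr rfl (g := fun _ => N)]
    · simp [mul_comm]
    · intro y hy
      rw [Finset.sum_boole, card_filter_bilinear_eq (hL y hy)]
  have hf2 : ∑ x, f x ^ 2 ≤ N * L.card + L.card ^ 2 := by
    have h1 : ∑ x, f x ^ 2 = ∑ y ∈ L, ∑ z ∈ L, ((Finset.univ.filter fun x : F × F =>
        x.1 * y.1 - x.2 * y.2 = d ∧ x.1 * z.1 - x.2 * z.2 = d).card : ℤ) := by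
      simp_rw [f, sq, Finset.sum_mul_sum]
      rw [Finset.sum_comm]
      refine Finset.sum_congr rfl fun y _ => ?_
      rw [Finset.sum_comm]
      refine Finset.sum_congr rfl fun z _ => ?_
      rw [← Finset.sum_boole]
      refine Finset.sum_congr rfl fun x _ => ?_
      split_ifs <;> simp_all
    rw [h1]
    calc _ ≤ ∑ y ∈ L, ∑ z ∈ L, ((if y = z then N else 0) + 1) := by
          refine Finset.sum_le_sum fun y hy => Finset.sum_le_sum fun z _ => ?_
          split_ifs with hyz
          · subst hyz
            simp only [and_self]
            rw [card_filter_bilinear_eq (hL y hy)]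
            omega
          · have := card_filter_bilinear_eq_and_eq_le_one hyz hd
            push_cast
            omega
      _ = _ := by
          simp only [Finset.sum_add_distrib, Finset.sum_ite_eq]
          simp [mul_comm, sq]
  have hf0 : ∀ x ∈ P, f x = 0 := fun x hx =>
    Finset.sum_eq_zero fun y hy => if_neg (hno x hx y hy)
  have hvar : ∑ x ∈ P, (N * f x - L.card) ^ 2 ≤ ∑ x, (N * f x - L.card) ^ 2 :=
    Finset.sum_le_sum_of_subset_of_nonneg (Finset.subset_univ _) fun _ _ _ => sq_nonneg _
  have hleft : ∑ x ∈ P, (N * f x - L.card) ^ 2 = P.card * (L.card : ℤ) ^ 2 := by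
    rw [Finset.sum_congr rfl (g := fun _ => (L.card : ℤ) ^ 2)]
    · simp
    · intro x hx
      rw [hf0 x hx]
      ring
  have hright : ∑ x, (N * f x - L.card) ^ 2 =
      N ^ 2 * ∑ x, f x ^ 2 - 2 * N * L.card * ∑ x, f x + N ^ 2 * L.card ^ 2 := by
    simp_rw [sub_sq, mul_pow, Finset.sum_add_distrib, Finset.sum_sub_distrib, Finset.mul_sum]
    congr 1
    · congr 1
      exact Finset.sum_congr rfl fun x _ => by ring
    · simp [hN, sq]
  rw [hleft, hright, hf1] at hvar
  have hle : (P.card * L.card : ℤ) * L.card ≤ N ^ 3 * L.card := by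
    nlinarith [mul_le_mul_of_nonneg_left hf2 (sq_nonneg N)]
  have hlt : N ^ 3 < (P.card * L.card : ℤ) := by
    rw [hN]
    exact_mod_cast h
  have hLpos : (0 : ℤ) < L.card := by
    rcases Nat.eq_zero_or_pos L.card with h0 | h0
    · rw [h0] at h
      omega
    · exact_mod_cast h0
  exact absurd hle (not_le.2 (mul_lt_mul_of_pos_right hlt hLpos))

end Bilinear

/-! ### Differences of an even and an odd power of `3` modulo a prime -/

theorem injOn_pow_of_pow_ne_one {F : Type*} [Field F] {a : F} (ha : a ≠ 0) {K : ℕ}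
    (h : ∀ l, 0 < l → l < K → a ^ l ≠ 1) : Set.InjOn (fun i : ℕ => a ^ i) (Set.Iio K) := by
  have key : ∀ i j : ℕ, i < j → j < K → a ^ i ≠ a ^ j := by
    intro i j hij hj he
    refine h (j - i) (by omega) (by omega) ?_
    have : a ^ i * a ^ (j - i) = a ^ i * 1 := by
      rw [← pow_add, Nat.add_sub_cancel' hij.le, mul_one, he]
    exact mul_left_cancel₀ (pow_ne_zero _ ha) this
  intro i hi j hj he
  rcases lt_trichotomy i j with hlt | heq | hlt
  · exact absurd he (key i j hlt hj)
  · exact heq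
  · exact absurd he.symm (key j i hlt hi)

theorem natCast_zmod_ne_zero {p : ℕ} {a : ℕ} (h : a.Coprime p) (hp : p.Prime) :
    (a : ZMod p) ≠ 0 := by
  rw [Ne, ZMod.natCast_eq_zero_iff]
  intro hd
  exact hp.one_lt.ne' (Nat.Coprime.eq_one_of_dvd h.symm hd)

theorem three_zmod_ne_zero {p : ℕ} (hp : p.Prime) (hp5 : 5 ≤ p) : (3 : ZMod p) ≠ 0 := by
  have h : Nat.Coprime 3 p := (Nat.coprime_primes Nat.prime_three hp).2 (by omega)
  exact_mod_cast natCast_zmod_ne_zero h hp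

theorem two_zmod_ne_zero {p : ℕ} (hp : p.Prime) (hp5 : 5 ≤ p) : (2 : ZMod p) ≠ 0 := by
  have h : Nat.Coprime 2 p := (Nat.coprime_primes Nat.prime_two hp).2 (by omega)
  exact_mod_cast natCast_zmod_ne_zero h hp

/-- For large `p`, the first `2 ^ k > p / 2` powers of `3` are so many that the even powers among
them contain a product set `B' H'`, the odd ones a product set `A' H`, with
`|A'| |B'| |H| |H'| > p ^ 3`. -/
theorem exists_pow_nine_sub_of_large {p k : ℕ} (hp : p.Prime) (hk : 11 ≤ k)
    (hlt : 2 ^ k < p) (hpk : p < 2 ^ (k + 1))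
    (hord : ∀ l : ℕ, 0 < l → 2 * l < 2 ^ k → (9 : ZMod p) ^ l ≠ 1) {d : ZMod p} (hd : d ≠ 0) :
    ∃ i j : ℕ, 1 ≤ i ∧ 2 * i ≤ 2 ^ k ∧ 2 * j ≤ 2 ^ k ∧ (9 : ZMod p) ^ i - 3 * 9 ^ j = d := by
  have : Fact p.Prime := ⟨hp⟩
  have h2k : 2 ^ 11 ≤ 2 ^ k := Nat.pow_le_pow_right (by norm_num) hk
  have h3 : (3 : ZMod p) ≠ 0 := three_zmod_ne_zero hp (by omega)
  have h9 : (9 : ZMod p) ≠ 0 := by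
    have : (9 : ZMod p) = 3 * 3 := by norm_num
    rw [this]
    exact mul_ne_zero h3 h3
  obtain ⟨m, rfl⟩ : ∃ m, k = m + 2 := ⟨k - 2, by omega⟩
  have hK : 2 ^ (m + 2) = 4 * 2 ^ m := by ring
  have hinj := injOn_pow_of_pow_ne_one (K := 2 ^ m) h9 fun l h0 hl => hord l h0 (by omega)
  set H : Finset (ZMod p) := (Finset.range (2 ^ m)).image fun i => (9 : ZMod p) ^ i with hH
  have hHcard : H.card = 2 ^ m := by
    rw [hH, Finset.card_image_of_injOn (by simpa using hinj), Finset.card_range]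
  have hmemH : ∀ {x}, x ∈ H ↔ ∃ i < 2 ^ m, (9 : ZMod p) ^ i = x := by simp [hH]
  have hB : (H.image fun x => 9 * x).card = 2 ^ m := by
    rw [Finset.card_image_of_injective _ (mul_right_injective₀ h9), hHcard]
  have hA : (H.image fun x => 3 * x).card = 2 ^ m := by
    rw [Finset.card_image_of_injective _ (mul_right_injective₀ h3), hHcard]
  obtain ⟨x, hx, y, hy, hxy⟩ := exists_bilinear_eq
    ((H.image fun x => 9 * x) ×ˢ (H.image fun x => 3 * x)) (H ×ˢ H) (by
      rintro ⟨y1, y2⟩ hy h0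
      obtain ⟨i, -, hi⟩ := hmemH.1 (Finset.mem_product.1 hy).1
      exact pow_ne_zero i h9 (hi.trans (Prod.ext_iff.1 h0).1)) hd (by
      rw [ZMod.card, Finset.card_product, Finset.card_product, hA, hB, hHcard]
      calc p ^ 3 < (2 ^ (m + 2 + 1)) ^ 3 := Nat.pow_lt_pow_left hpk (by norm_num)
        _ = 2 ^ (3 * m + 9) := by ring
        _ ≤ 2 ^ (4 * m) := Nat.pow_le_pow_right (by norm_num) (by omega)
        _ = _ := by ring)
  rw [Finset.mem_product, Finset.mem_image, Finset.mem_image] at hx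
  rw [Finset.mem_product, hmemH, hmemH] at hy
  obtain ⟨⟨u, hu, hu1⟩, v, hv, hv1⟩ := hx
  obtain ⟨⟨i, hi, hi1⟩, j, hj, hj1⟩ := hy
  obtain ⟨s, hs, rfl⟩ := hmemH.1 hu
  obtain ⟨t, ht, rfl⟩ := hmemH.1 hv
  refine ⟨s + i + 1, t + j, by omega, by omega, by omega, ?_⟩
  rw [← hxy, ← hu1, ← hv1, ← hi1, ← hj1]
  ring

/-- The number whose binary digits `1` stand at the places `9 ^ j % p`, `s ≤ j < s + 2 ^ k`. -/
def powerMask (p : ℕ) : ℕ → ℕ → ℕ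
  | 0, s => 2 ^ (9 ^ s % p)
  | k + 1, s => powerMask p k s ||| powerMask p k (s + 2 ^ k)

/-- The number whose binary digits `1` stand at the places `y + (p - 3 * 9 ^ j % p)`, where
`s ≤ j < s + 2 ^ k` and `y` is the place of a binary digit `1` of `M`. -/
def differenceMask (p M : ℕ) : ℕ → ℕ → ℕ
  | 0, s => M <<< (p - 3 * 9 ^ s % p)
  | k + 1, s => differenceMask p M k s ||| differenceMask p M k (s + 2 ^ k)

/-- A test that every non-zero residue modulo `p` is a difference of an even power `9 ^ i`,
`1 ≤ i ≤ 2 ^ (k - 1)`, and an odd power `3 * 9 ^ j`, `j ≤ 2 ^ (k - 1)`. It tries only the first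
`32` values of `j` and the last one; the differences are collected modulo `p` as binary digits of one number. -/
def coversNonzero (k p : ℕ) : Bool :=
  let M := powerMask p (k - 1) 1
  let D := differenceMask p M (min (k - 1) 5) 0 ||| differenceMask p M 0 (2 ^ (k - 1))
  (D ||| D >>> p) &&& (2 ^ p - 2) == 2 ^ p - 2

/-- A test that `p = 7`, or `p` is not a prime `≥ 5`, or the order of `9` modulo `p` is at most
`(p - 1) / 4`, or `coversNonzero k p` holds. Primality is tested only by divisibility by `2` and `3`
and by Fermat's congruence; the order only with exponents `(p - 1) / 2 / r` for small `r`. -/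
def testModulus (k p : ℕ) : Bool :=
  p % 2 == 0 || p % 3 == 0 || p == 7 || 9 ^ ((p - 1) / 2) % p != 1 ||
  (List.range 30).any (fun r => Nat.ble 1 ((p - 1) / 2 / (r + 2)) &&
    9 ^ ((p - 1) / 2 / (r + 2)) % p == 1) ||
  coversNonzero k p

theorem testModulus_of_lt :
    ((List.range 11).all fun k => (List.range (2 ^ k)).all fun i =>
      Nat.ble (2 ^ k + i) 4 || i == 0 || testModulus k (2 ^ k + i)) = true := by
  decide +kernel

theorem exists_of_testBit_powerMask {p : ℕ} {i : ℕ} : ∀ {k s : ℕ},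
    (powerMask p k s).testBit i = true → ∃ j, s ≤ j ∧ j < s + 2 ^ k ∧ 9 ^ j % p = i
  | 0, s, h => by
    rw [powerMask, Nat.testBit_two_pow] at h
    exact ⟨s, le_rfl, by simp, by simpa using h⟩
  | k + 1, s, h => by
    rw [powerMask, Nat.testBit_or, Bool.or_eq_true] at h
    rw [pow_succ]
    rcases h with h | h
    · obtain ⟨j, h1, h2, h3⟩ := exists_of_testBit_powerMask h
      exact ⟨j, h1, by omega, h3⟩
    · obtain ⟨j, h1, h2, h3⟩ := exists_of_testBit_powerMask h
      exact ⟨j, by omega, by omega, h3⟩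

theorem exists_of_testBit_differenceMask {p M : ℕ} {i : ℕ} : ∀ {k s : ℕ},
    (differenceMask p M k s).testBit i = true → ∃ j, s ≤ j ∧ j < s + 2 ^ k ∧
      ∃ y, M.testBit y = true ∧ y + (p - 3 * 9 ^ j % p) = i
  | 0, s, h => by
    rw [differenceMask, Nat.testBit_shiftLeft, Bool.and_eq_true, decide_eq_true_eq] at h
    exact ⟨s, le_rfl, by simp, _, h.2, by omega⟩
  | k + 1, s, h => by
    rw [differenceMask, Nat.testBit_or, Bool.or_eq_true] at h
    rw [pow_succ]
    rcases h with h | h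
    · obtain ⟨j, h1, h2, h3⟩ := exists_of_testBit_differenceMask h
      exact ⟨j, h1, by omega, h3⟩
    · obtain ⟨j, h1, h2, h3⟩ := exists_of_testBit_differenceMask h
      exact ⟨j, by omega, by omega, h3⟩

theorem exists_of_coversNonzero {p k : ℕ} (hp : p.Prime) (hk : 1 ≤ k)
    (h : coversNonzero k p = true) {d : ZMod p} (hd : d ≠ 0) :
    ∃ i j : ℕ, 1 ≤ i ∧ 2 * i ≤ 2 ^ k ∧ 2 * j ≤ 2 ^ k ∧ (9 : ZMod p) ^ i - 3 * 9 ^ j = d := by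
  have : NeZero p := ⟨hp.ne_zero⟩
  set D := differenceMask p (powerMask p (k - 1) 1) (min (k - 1) 5) 0 |||
    differenceMask p (powerMask p (k - 1) 1) 0 (2 ^ (k - 1)) with hD
  have hbit : (D.testBit d.val || D.testBit (p + d.val)) = true := by
    have h1 : (D ||| D >>> p) &&& (2 ^ p - 2) = 2 ^ p - 2 := by
      simpa [coversNonzero] using h
    have h2 : (2 ^ p - 2).testBit d.val = true := by
      rw [show 2 ^ p - 2 = 2 ^ p - (1 + 1) by rfl, Nat.testBit_two_pow_sub_succ
        (Nat.one_lt_two_pow hp.ne_zero)]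
      have : d.val ≠ 0 := by rwa [Ne, ZMod.val_eq_zero]
      have : Nat.testBit 1 d.val = false := by
        rw [← pow_zero 2, Nat.testBit_two_pow]
        simpa using this.symm
      simp [this, ZMod.val_lt]
    rw [← h1, Nat.testBit_and, Bool.and_eq_true, Nat.testBit_or, Nat.testBit_shiftRight] at h2
    exact h2.1
  obtain ⟨e, he, hed⟩ : ∃ e, D.testBit e = true ∧ (e : ZMod p) = d := by
    rcases Bool.or_eq_true _ _ ▸ hbit with h | h
    · exact ⟨_, h, by simp⟩
    · exact ⟨_, h, by simp⟩
  have hmin : 2 ^ min (k - 1) 5 ≤ 2 ^ (k - 1) :=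
    Nat.pow_le_pow_right (by norm_num) (min_le_left _ _)
  obtain ⟨j, hj, y, hy, hye⟩ : ∃ j ≤ 2 ^ (k - 1), ∃ y,
      (powerMask p (k - 1) 1).testBit y = true ∧ y + (p - 3 * 9 ^ j % p) = e := by
    rw [hD, Nat.testBit_or, Bool.or_eq_true] at he
    rcases he with he | he
    · obtain ⟨j, -, hj, h⟩ := exists_of_testBit_differenceMask he
      exact ⟨j, by omega, h⟩
    · obtain ⟨j, -, hj, h⟩ := exists_of_testBit_differenceMask he
      exact ⟨j, by omega, h⟩
  obtain ⟨i, hi1, hi2, rfl⟩ := exists_of_testBit_powerMask hy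
  have hpow : 2 ^ k = 2 * 2 ^ (k - 1) := by
    rw [← pow_succ', Nat.sub_add_cancel hk]
  refine ⟨i, j, hi1, by omega, by omega, ?_⟩
  rw [← hed, ← hye, Nat.cast_add, Nat.cast_sub (Nat.mod_lt _ hp.pos).le]
  simp [sub_eq_add_neg]

/-- If the powers `9 ^ l` with `2 l ≤ p / 2`, roughly, are different from `1`, then every non-zero
residue modulo the prime `p` is a difference of an even and an odd one of the first `2 ^ k + 1` powers
of `3`, where `2 ^ k` is the largest power of `2` below `p`. For `p = 7` the residue `2` is not of
this form. -/
theorem exists_pow_nine_sub {p k : ℕ} (hp : p.Prime) (hp5 : 5 ≤ p) (hp7 : p ≠ 7)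
    (hlt : 2 ^ k < p) (hpk : p < 2 ^ (k + 1))
    (hord : ∀ l : ℕ, 0 < l → 2 * l < 2 ^ k → (9 : ZMod p) ^ l ≠ 1) {d : ZMod p} (hd : d ≠ 0) :
    ∃ i j : ℕ, 1 ≤ i ∧ 2 * i ≤ 2 ^ k ∧ 2 * j ≤ 2 ^ k ∧ (9 : ZMod p) ^ i - 3 * 9 ^ j = d := by
  rcases le_or_gt 11 k with hk | hk
  · exact exists_pow_nine_sub_of_large hp hk hlt hpk hord hd
  have : Fact p.Prime := ⟨hp⟩
  have hk1 : 1 ≤ k := by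
    rcases Nat.eq_zero_or_pos k with rfl | h
    · norm_num at hpk
      omega
    · exact h
  have hmod : ∀ l : ℕ, 9 ^ l % p = 1 ↔ (9 : ZMod p) ^ l = 1 := by
    intro l
    have := ZMod.natCast_eq_natCast_iff' (9 ^ l) 1 p
    rw [Nat.mod_eq_of_lt (show 1 < p by omega)] at this
    rw [← this]
    push_cast
    rfl
  have h := testModulus_of_lt
  rw [List.all_eq_true] at h
  have h := h k (List.mem_range.2 hk)
  rw [List.all_eq_true] at h
  have h := h (p - 2 ^ k) (List.mem_range.2 (by rw [pow_succ] at hpk; omega))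
  rw [Nat.add_sub_cancel' hlt.le] at h
  have h4 : Nat.ble p 4 = false := by
    rw [Bool.eq_false_iff, Ne, Nat.ble_eq]
    omega
  have h0 : (p - 2 ^ k == 0) = false := by
    rw [beq_eq_false_iff_ne]
    omega
  have h2 : (p % 2 == 0) = false := by
    rw [beq_eq_false_iff_ne]
    intro h
    have := (Nat.prime_dvd_prime_iff_eq Nat.prime_two hp).1 (Nat.dvd_of_mod_eq_zero h)
    omega
  have h3 : (p % 3 == 0) = false := by
    rw [beq_eq_false_iff_ne]
    intro h
    have := (Nat.prime_dvd_prime_iff_eq Nat.prime_three hp).1 (Nat.dvd_of_mod_eq_zero h)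
    omega
  have h7 : (p == 7) = false := by rwa [beq_eq_false_iff_ne]
  have hF : (9 ^ ((p - 1) / 2) % p != 1) = false := by
    rw [bne_eq_false_iff_eq, hmod]
    have hodd : 2 * ((p - 1) / 2) = p - 1 := by
      rw [beq_eq_false_iff_ne] at h2
      omega
    rw [show (9 : ZMod p) = 3 ^ 2 by norm_num, ← pow_mul, hodd]
    exact ZMod.pow_card_sub_one_eq_one (three_zmod_ne_zero hp hp5)
  have hr : (List.range 30).any (fun r => Nat.ble 1 ((p - 1) / 2 / (r + 2)) &&
      9 ^ ((p - 1) / 2 / (r + 2)) % p == 1) = false := by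
    rw [List.any_eq_false]
    intro r _
    rw [Bool.and_eq_true, not_and, Nat.ble_eq, beq_iff_eq, hmod]
    intro h1
    refine hord _ h1 ?_
    have : (p - 1) / 2 / (r + 2) ≤ (p - 1) / 2 / 2 := Nat.div_le_div_left (by omega) (by norm_num)
    rw [pow_succ] at hpk
    omega
  simp only [h4, h0, testModulus, h2, h3, h7, hF, hr, Bool.false_or] at h
  exact exists_of_coversNonzero hp hk1 h hd

/-! ### Collisions -/

theorem two_mul_half_pred_eq {p : ℕ} (hp : p.Prime) (hp5 : 5 ≤ p) : 2 * ((p - 1) / 2) = p - 1 := by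
  obtain ⟨c, hc⟩ := hp.odd_of_ne_two (by omega)
  omega

theorem browkinSalajan_modEq_iff {q : ℕ} (hq : Odd q) (m : ℕ) (i j : ℕ) :
    browkinSalajan q i ≡ browkinSalajan q j [ZMOD m] ↔
      (4 * m : ℤ) ∣ (3 ^ j - qStar q * (-1) ^ j) - (3 ^ i - qStar q * (-1) ^ i) := by
  rw [← four_mul_browkinSalajan hq, ← four_mul_browkinSalajan hq, ← mul_sub,
    mul_dvd_mul_iff_left (by norm_num), Int.modEq_iff_dvd]

theorem Discriminates.le {v : ℕ → ℤ} {n m : ℕ} (h : Discriminates v n m) (hm : 0 < m) :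
    n ≤ m := by
  have : NeZero m := ⟨hm.ne'⟩
  have hinj : Set.InjOn (fun i : ℕ => (v i : ZMod m)) (Finset.Icc 1 n : Finset ℕ) := by
    intro i hi j hj hij
    rw [Finset.coe_Icc] at hi hj
    rcases lt_trichotomy i j with hlt | heq | hlt
    · exact absurd ((ZMod.intCast_eq_intCast_iff _ _ _).1 hij) (h i j hi.1 hlt hj.2)
    · exact heq
    · exact absurd ((ZMod.intCast_eq_intCast_iff _ _ _).1 hij.symm) (h j i hj.1 hlt hi.2)
  have := Finset.card_le_card_of_injOn (t := Finset.univ) _ (fun _ _ => Finset.mem_univ _) hinj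
  simpa [ZMod.card] using this

/-- The sequence modulo `m` is ultimately periodic: an even `P` with `3 ^ (s + P) ≡ 3 ^ s` modulo
`4 m` is a period from the index `s` on. -/
theorem Discriminates.lt_add_of_dvd {q n m s P : ℕ} (hq : Odd q)
    (h : Discriminates (browkinSalajan q) n m) (hs : 1 ≤ s) (hP : 0 < P) (hPe : Even P)
    (hd : (4 * m : ℤ) ∣ 3 ^ s * (3 ^ P - 1)) : n < s + P := by
  by_contra! hn
  refine h s (s + P) hs (by omega) hn ?_
  rw [browkinSalajan_modEq_iff hq]
  have : ((3 : ℤ) ^ (s + P) - qStar q * (-1) ^ (s + P)) - (3 ^ s - qStar q * (-1) ^ s)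
      = 3 ^ s * (3 ^ P - 1) := by
    rw [pow_add (-1 : ℤ), hPe.neg_one_pow, pow_add]
    ring
  rwa [this]

theorem Discriminates.not_dvd_of_odd {q n m i j : ℕ} (hq : Odd q) (hm : Odd m)
    (h : Discriminates (browkinSalajan q) n m) (hi : 1 ≤ i) (hin : i ≤ n) (hj : 1 ≤ j)
    (hjn : j ≤ n) (hij : i ≠ j) :
    ¬ (m : ℤ) ∣ (3 ^ j - qStar q * (-1) ^ j) - (3 ^ i - qStar q * (-1) ^ i) := by
  intro hd
  have h4 : IsCoprime (m : ℤ) 4 := by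
    have : Nat.Coprime m (2 ^ 2) := hm.coprime_two_right.pow_right 2
    exact_mod_cast Nat.isCoprime_iff_coprime.2 this
  have hd' : (m : ℤ) ∣ browkinSalajan q j - browkinSalajan q i := by
    rw [← four_mul_browkinSalajan hq, ← four_mul_browkinSalajan hq, ← mul_sub] at hd
    exact h4.dvd_of_dvd_mul_left hd
  rcases lt_or_gt_of_ne hij with hlt | hlt
  · exact h i j hi hlt hjn (Int.modEq_iff_dvd.2 hd')
  · exact h j i hj hlt hin (Int.modEq_iff_dvd.2 hd').symm

theorem Discriminates.not_dvd_even_sub_odd {q n m i j : ℕ} (hq : Odd q) (hm : Odd m)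
    (h : Discriminates (browkinSalajan q) n m) (hi : 1 ≤ i) (hin : i ≤ n) (hj : 1 ≤ j)
    (hjn : j ≤ n) (hie : Even i) (hjo : Odd j) :
    ¬ (m : ℤ) ∣ 3 ^ i - 3 ^ j - 2 * qStar q := by
  intro hd
  refine h.not_dvd_of_odd hq hm hj hjn hi hin (fun he => ?_) ?_
  · subst he
    exact Nat.not_even_iff_odd.2 hjo hie
  · rw [hie.neg_one_pow, hjo.neg_one_pow]
    convert hd using 1
    ring

/-! ### Even exponents `P` with `3 ^ P ≡ 1` modulo `4 m` -/

theorem three_pow_sub_one_dvd {x P : ℕ} (h : x ∣ P) : (3 : ℤ) ^ x - 1 ∣ 3 ^ P - 1 := by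
  obtain ⟨y, rfl⟩ := h
  rw [pow_mul]
  simpa using sub_dvd_pow_sub_pow ((3 : ℤ) ^ x) 1 y

theorem two_pow_dvd_three_pow_sub_one {a : ℕ} (ha : 1 ≤ a) :
    (2 : ℤ) ^ (a + 2) ∣ 3 ^ 2 ^ a - 1 := by
  induction a, ha using Nat.le_induction with
  | base => norm_num
  | succ a ha ih =>
    have h2 : (2 : ℤ) ∣ 3 ^ 2 ^ a + 1 := by
      have : Odd ((3 : ℤ) ^ 2 ^ a) := Odd.pow (by decide)
      exact (this.add_one).two_dvd
    have : (3 : ℤ) ^ 2 ^ (a + 1) - 1 = (3 ^ 2 ^ a - 1) * (3 ^ 2 ^ a + 1) := by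
      rw [pow_succ, pow_mul]
      ring
    rw [this, show a + 1 + 2 = a + 2 + 1 by ring, pow_succ]
    exact mul_dvd_mul ih h2

theorem dvd_three_pow_totient_sub_one {k : ℕ} (h : Nat.Coprime 3 k) :
    (k : ℤ) ∣ 3 ^ k.totient - 1 := by
  have := (Nat.modEq_iff_dvd.1 (Nat.ModEq.pow_totient h).symm)
  exact_mod_cast this

theorem four_dvd_three_pow_sub_one {P : ℕ} (h : Even P) : (4 : ℤ) ∣ 3 ^ P - 1 :=
  (show (4 : ℤ) ∣ 3 ^ 2 - 1 by norm_num).trans (three_pow_sub_one_dvd h.two_dvd)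

theorem four_mul_dvd_three_pow_sub_one {m P : ℕ} (hm : Odd m) (hP : Even P)
    (h : (m : ℤ) ∣ 3 ^ P - 1) : (4 * m : ℤ) ∣ 3 ^ P - 1 := by
  have h4 : IsCoprime (4 : ℤ) m := by
    have : Nat.Coprime (2 ^ 2) m := hm.coprime_two_left.pow_left 2
    exact_mod_cast Nat.isCoprime_iff_coprime.2 this
  exact h4.mul_dvd (four_dvd_three_pow_sub_one hP) h

theorem dvd_totient_mul_half_totient {x k : ℕ} (hk : 2 < k) (hx : Even x) :
    x ∣ x / 2 * k.totient ∧ k.totient ∣ x / 2 * k.totient ∧ Even (x / 2 * k.totient) := by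
  obtain ⟨c, hc⟩ := (Nat.totient_even hk).two_dvd
  obtain ⟨d, hd⟩ := hx.two_dvd
  have hx2 : x / 2 = d := by omega
  refine ⟨⟨c, ?_⟩, Dvd.intro_left _ rfl, (Nat.totient_even hk).mul_left _⟩
  rw [hx2, hc, hd]
  ring

/-- An even exponent `P` with `3 ^ P ≡ 1` modulo `4 m` that is at most `m`, and at most `m / 2`
unless `m` is a power of `2` or of another prime: the exponents belonging to coprime factors are
all even, so that their least common multiple is at most half their product. -/
theorem exists_even_exponent {m : ℕ} (hm : 2 ≤ m) (h3 : Nat.Coprime 3 m) :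
    ∃ P : ℕ, 0 < P ∧ Even P ∧ (4 * m : ℤ) ∣ 3 ^ P - 1 ∧ P ≤ m ∧
      (2 * P ≤ m ∨ (∃ a, m = 2 ^ a) ∨ ∃ p b, p.Prime ∧ 5 ≤ p ∧ 1 ≤ b ∧ m = p ^ b) := by
  obtain ⟨a, k, hk, rfl⟩ := Nat.exists_eq_two_pow_mul_odd (n := m) (by omega)
  have h3k : Nat.Coprime 3 k := h3.coprime_mul_left_right
  have hklt : k.totient ≤ k := Nat.totient_le k
  rcases Nat.eq_zero_or_pos a with rfl | ha
  · rw [pow_zero, one_mul] at *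
    have hk2 : 2 < k := by
      obtain ⟨c, rfl⟩ := hk
      omega
    set p := k.minFac with hp
    have hpp : p.Prime := Nat.minFac_prime (by omega)
    have hpk : p ∣ k := Nat.minFac_dvd k
    have hp5 : 5 ≤ p := by
      have h2 : p ≠ 2 := by
        intro h
        rw [h] at hpk
        exact Nat.not_even_iff_odd.2 hk (even_iff_two_dvd.2 hpk)
      have h3 : p ≠ 3 := by
        intro h
        rw [h] at hpk
        have := Nat.Coprime.eq_one_of_dvd h3k hpk
        omega
      have h4 : p ≠ 4 := by
        intro h
        rw [h] at hpp
        norm_num at hpp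
      have := hpp.two_le
      omega
    obtain ⟨b, c, hc, hkc⟩ := Nat.exists_eq_pow_mul_and_not_dvd (n := k) (by omega) p hpp.ne_one
    have hb : b ≠ 0 := by
      rintro rfl
      rw [pow_zero, one_mul] at hkc
      exact hc (hkc ▸ hpk)
    rcases Nat.lt_or_ge c 2 with hc2 | hc2
    · have hc1 : c = 1 := by
        rcases Nat.eq_zero_or_pos c with h | h
        · exact absurd (h ▸ dvd_zero p) hc
        · omega
      have heven := Nat.totient_even hk2
      refine ⟨k.totient, Nat.totient_pos.2 (by omega), heven,
        four_mul_dvd_three_pow_sub_one hk heven (dvd_three_pow_totient_sub_one h3k), hklt,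
        Or.inr (Or.inr ⟨p, b, hpp, hp5, by omega, ?_⟩)⟩
      rw [hkc, hc1, mul_one]
    · have hodd : Odd (p ^ b) ∧ Odd c := Nat.odd_mul.1 (hkc ▸ hk)
      have hcop : Nat.Coprime (p ^ b) c := ((Nat.Prime.coprime_iff_not_dvd hpp).2 hc).pow_left b
      have hcc : Nat.Coprime 3 (p ^ b) ∧ Nat.Coprime 3 c := by
        rw [hkc] at h3k
        exact ⟨h3k.coprime_mul_right_right, h3k.coprime_mul_left_right⟩
      have hpb : 5 ≤ p ^ b := hp5.trans (Nat.le_self_pow hb p)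
      have hc3 : 2 < c := by
        obtain ⟨d, hd⟩ := hodd.2
        omega
      have heven := Nat.totient_even (n := p ^ b) (by omega)
      obtain ⟨hd1, hd2, hd3⟩ := dvd_totient_mul_half_totient hc3 heven
      have hpos : 0 < (p ^ b).totient / 2 := by
        have := Nat.totient_pos.2 (show 0 < p ^ b by omega)
        obtain ⟨d, hd⟩ := heven
        omega
      have hle : 2 * ((p ^ b).totient / 2 * c.totient) ≤ k := by
        rw [← mul_assoc, hkc]
        exact Nat.mul_le_mul (le_trans (Nat.mul_div_le _ _) (Nat.totient_le _)) (Nat.totient_le _)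
      refine ⟨(p ^ b).totient / 2 * c.totient, Nat.mul_pos hpos (Nat.totient_pos.2 (by omega)),
        hd3, four_mul_dvd_three_pow_sub_one hk hd3 ?_, by omega, Or.inl hle⟩
      rw [hkc, Nat.cast_mul]
      refine IsCoprime.mul_dvd (Nat.isCoprime_iff_coprime.2 hcop) ?_ ?_
      · exact (dvd_three_pow_totient_sub_one hcc.1).trans (three_pow_sub_one_dvd hd1)
      · exact (dvd_three_pow_totient_sub_one hcc.2).trans (three_pow_sub_one_dvd hd2)
  · have h2a : Even (2 ^ a) := (Nat.even_pow.2 ⟨even_two, by omega⟩)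
    rcases Nat.lt_or_ge k 2 with hk2 | hk2
    · have hk1 : k = 1 := by
        obtain ⟨c, rfl⟩ := hk
        omega
      subst hk1
      refine ⟨2 ^ a, by positivity, h2a, ?_, by simp, Or.inr (Or.inl ⟨a, by simp⟩)⟩
      have := two_pow_dvd_three_pow_sub_one ha
      rw [pow_add, mul_comm] at this
      simpa using this
    · have hk3 : 2 < k := by
        obtain ⟨c, rfl⟩ := hk
        omega
      obtain ⟨hd1, hd2, hd3⟩ := dvd_totient_mul_half_totient hk3 h2a
      have hhalf : 2 * (2 ^ a / 2) = 2 ^ a := Nat.mul_div_cancel' h2a.two_dvd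
      have hle : 2 * (2 ^ a / 2 * k.totient) ≤ 2 ^ a * k := by
        rw [← mul_assoc, hhalf]
        exact Nat.mul_le_mul_left _ hklt
      have hpos : 0 < 2 ^ a / 2 := by
        have : 0 < 2 ^ a := by positivity
        omega
      refine ⟨2 ^ a / 2 * k.totient, Nat.mul_pos hpos (Nat.totient_pos.2 (by omega)), hd3, ?_,
        by omega, Or.inl hle⟩
      have hcop : IsCoprime ((2 : ℤ) ^ (a + 2)) k := by
        have : Nat.Coprime (2 ^ (a + 2)) k := hk.coprime_two_left.pow_left _
        exact_mod_cast Nat.isCoprime_iff_coprime.2 this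
      have := hcop.mul_dvd ((two_pow_dvd_three_pow_sub_one ha).trans (three_pow_sub_one_dvd hd1))
        ((dvd_three_pow_totient_sub_one h3k).trans (three_pow_sub_one_dvd hd2))
      push_cast
      rwa [show (4 * (2 ^ a * k) : ℤ) = 2 ^ (a + 2) * k by ring]

/-- A modulus strictly below the least power of `2` that is at least `n` can separate the first
`n` terms only if it is a power of a prime `p ≥ 5`: for every other modulus the period is too
short. -/
theorem Discriminates.exists_prime_pow {q n m k : ℕ} (hq : Odd q)
    (h : Discriminates (browkinSalajan q) n m) (hm : 0 < m) (hk : 2 ^ k < n)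
    (hmk : m < 2 ^ (k + 1)) : ∃ p b, p.Prime ∧ 5 ≤ p ∧ 1 ≤ b ∧ m = p ^ b := by
  have hnm := h.le hm
  have hk1 : 1 ≤ 2 ^ k := Nat.one_le_two_pow
  rw [pow_succ] at hmk
  by_cases h3 : 3 ∣ m
  · exfalso
    obtain ⟨a, c, hc, hmc⟩ := Nat.exists_eq_pow_mul_and_not_dvd hm.ne' 3 (by norm_num)
    have hcop : Nat.Coprime 3 c := (Nat.Prime.coprime_iff_not_dvd Nat.prime_three).2 hc
    have ha : 1 ≤ a := by
      by_contra! h0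
      obtain rfl : a = 0 := by omega
      rw [pow_zero, one_mul] at hmc
      exact hc (hmc ▸ h3)
    have key : ∀ P : ℕ, 0 < P → Even P → (4 * c : ℤ) ∣ 3 ^ P - 1 → n < a + P := by
      intro P hP hPe hd
      refine h.lt_add_of_dvd hq ha hP hPe ?_
      rw [hmc]
      push_cast
      rw [show (4 * (3 ^ a * c) : ℤ) = 3 ^ a * (4 * c) by ring]
      exact mul_dvd_mul_left _ hd
    have h3a : 2 * a + 1 ≤ 3 ^ a := by
      have := one_add_mul_le_pow (show (-2 : ℤ) ≤ 2 by norm_num) a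
      norm_num at this
      have h' : ((2 * a + 1 : ℕ) : ℤ) ≤ ((3 ^ a : ℕ) : ℤ) := by
        push_cast
        linarith
      exact_mod_cast h'
    rcases Nat.lt_or_ge c 2 with hc2 | hc2
    · have hc1 : c = 1 := by
        rcases Nat.eq_zero_or_pos c with h | h
        · exact absurd (h ▸ dvd_zero 3) hc
        · omega
      have := key 2 (by norm_num) even_two (by rw [hc1]; norm_num)
      rw [hc1, mul_one] at hmc
      -- here `n = a + 1`, and `3 ^ a < 2 n` leaves only `m = 3`, `n = 2`, not below `2 ^ 1`
      have ha1 : a = 1 := by omega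
      subst ha1
      have hn2 : n = 2 := by omega
      omega
    · obtain ⟨P, hP, hPe, hd, hle, -⟩ := exists_even_exponent hc2 hcop
      have := key P hP hPe hd
      have : (2 * a + 1) * c ≤ m := hmc ▸ Nat.mul_le_mul_right c h3a
      nlinarith
  · have hcop : Nat.Coprime 3 m := (Nat.Prime.coprime_iff_not_dvd Nat.prime_three).2 h3
    obtain ⟨P, hP, hPe, hd, -, hcase⟩ := exists_even_exponent (m := m) (by omega) hcop
    have hlt := h.lt_add_of_dvd hq le_rfl hP hPe (hd.mul_left _)
    rcases hcase with hle | ⟨a, rfl⟩ | hpp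
    · omega
    · have h1 : k < a := (Nat.pow_lt_pow_iff_right (a := 2) (by norm_num)).1 (hk.trans_le hnm)
      have h2 : a < k + 1 :=
        (Nat.pow_lt_pow_iff_right (a := 2) (by norm_num)).1 (by rwa [pow_succ])
      omega
    · exact hpp

/-! ### Prime power moduli -/

theorem pow_succ_dvd_three_pow_sub_one {p r : ℕ} (c : ℕ) (h : (p : ℤ) ∣ 3 ^ r - 1) :
    ((p ^ (c + 1) : ℕ) : ℤ) ∣ 3 ^ (r * p ^ c) - 1 := by
  have := dvd_sub_pow_of_dvd_sub h c
  rw [one_pow, ← pow_mul] at this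
  exact_mod_cast this

/-- If the first `n > p ^ (b + 1) / 2` terms are distinct modulo `p ^ (b + 1)`, then `9` has the
largest possible order modulo `p`. -/
theorem Discriminates.isPrimitiveRoot_nine {q n p b : ℕ} (hq : Odd q) (hp : p.Prime)
    (hp5 : 5 ≤ p) (h : Discriminates (browkinSalajan q) n (p ^ (b + 1)))
    (hn : p ^ (b + 1) < 2 * n) : IsPrimitiveRoot (9 : ZMod p) ((p - 1) / 2) := by
  have : Fact p.Prime := ⟨hp⟩
  have hh := two_mul_half_pred_eq hp hp5
  have h1 : (9 : ZMod p) ^ ((p - 1) / 2) = 1 := by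
    rw [show (9 : ZMod p) = 3 ^ 2 by norm_num, ← pow_mul, hh]
    exact ZMod.pow_card_sub_one_eq_one (three_zmod_ne_zero hp hp5)
  have hpos : 0 < (p - 1) / 2 := by omega
  have hdvd := orderOf_dvd_of_pow_eq_one h1
  set r := orderOf (9 : ZMod p) with hr
  have hr0 : 0 < r := Nat.pos_of_dvd_of_pos hdvd hpos
  suffices hreq : r = (p - 1) / 2 by
    rw [← hreq]
    exact IsPrimitiveRoot.orderOf _
  by_contra hne
  obtain ⟨c, hc⟩ := hdvd
  have hc2 : 2 ≤ c := by
    rcases c with _ | _ | c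
    · omega
    · omega
    · omega
  have h2r : 4 * r ≤ p - 1 := by
    have : r * 2 ≤ r * c := Nat.mul_le_mul_left r hc2
    omega
  have hpr : (p : ℤ) ∣ 3 ^ (2 * r) - 1 := by
    rw [← ZMod.intCast_zmod_eq_zero_iff_dvd]
    push_cast
    rw [pow_mul, show (3 : ZMod p) ^ 2 = 9 by norm_num, hr, pow_orderOf_eq_one, sub_self]
  have heven : Even (2 * r * p ^ b) := (even_two_mul r).mul_right _
  have hpb : 0 < p ^ b := pow_pos hp.pos _
  have hlt := h.lt_add_of_dvd hq le_rfl (Nat.mul_pos (by omega) hpb) heven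
    ((four_mul_dvd_three_pow_sub_one ((hp.odd_of_ne_two (by omega)).pow) heven
      (pow_succ_dvd_three_pow_sub_one b hpr)).mul_left _)
  have h3 : 4 * r * p ^ b ≤ (p - 1) * p ^ b := Nat.mul_le_mul_right _ h2r
  have h4 : (p - 1) * p ^ b < p * p ^ b := Nat.mul_lt_mul_of_pos_right (by omega) hpb
  rw [pow_succ'] at hn
  have h5 : 4 * r * p ^ b = 2 * (2 * r * p ^ b) := by ring
  omega

/-- Terms that are congruent modulo `p` have at most `p ^ b` different residues modulo
`p ^ (b + 1)`. -/
theorem Discriminates.card_le_of_dvd {q n p b : ℕ} (hq : Odd q) (hp : p.Prime) (hp5 : 5 ≤ p)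
    (h : Discriminates (browkinSalajan q) n (p ^ (b + 1))) (J : Finset ℕ) (c : ℤ)
    (hJ : ∀ j ∈ J, 1 ≤ j ∧ j ≤ n ∧ (p : ℤ) ∣ (3 ^ j - qStar q * (-1) ^ j) - c) :
    J.card ≤ p ^ b := by
  have : NeZero (p ^ b) := ⟨(pow_pos hp.pos b).ne'⟩
  have hinj : Set.InjOn (fun j : ℕ =>
      ((((3 ^ j - qStar q * (-1) ^ j) - c) / (p : ℤ) : ℤ) : ZMod (p ^ b))) (J : Set ℕ) := by
    intro i hi j hj hij
    obtain ⟨hi1, hin, x, hx⟩ := hJ i hi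
    obtain ⟨hj1, hjn, y, hy⟩ := hJ j hj
    have hp0 : (p : ℤ) ≠ 0 := by exact_mod_cast hp.ne_zero
    simp only [hx, hy, Int.mul_ediv_cancel_left _ hp0] at hij
    rw [ZMod.intCast_eq_intCast_iff, Int.modEq_iff_dvd] at hij
    by_contra hne
    refine h.not_dvd_of_odd hq ((hp.odd_of_ne_two (by omega)).pow) hi1 hin hj1 hjn hne ?_
    have : (3 ^ j - qStar q * (-1) ^ j) - (3 ^ i - qStar q * (-1) ^ i) = (p : ℤ) * (y - x) := by
      linear_combination hy - hx
    rw [this, pow_succ']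
    push_cast at hij ⊢
    exact mul_dvd_mul_left _ hij
  have := Finset.card_le_card_of_injOn (t := Finset.univ) _ (fun _ _ => Finset.mem_univ _) hinj
  simpa [ZMod.card] using this

/-- A collision modulo `p` of an even and an odd index lifts to the higher powers of `p`: more than
half of the indices in each of the two residue classes modulo `p - 1` are at most `n`. -/
theorem Discriminates.not_dvd_of_higher_pow {q n p b i j : ℕ} (hq : Odd q) (hp : p.Prime)
    (hp5 : 5 ≤ p) (hb : 1 ≤ b) (h : Discriminates (browkinSalajan q) n (p ^ (b + 1)))
    (hn : p ^ (b + 1) < 2 * n) (hi : 1 ≤ i) (hip : i ≤ p - 1) (hj : 1 ≤ j) (hjp : j ≤ p - 1)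
    (hie : Even i) (hjo : Odd j) : ¬ (p : ℤ) ∣ 3 ^ i - 3 ^ j - 2 * qStar q := by
  intro hd
  have : Fact p.Prime := ⟨hp⟩
  have hpodd : Odd p := hp.odd_of_ne_two (by omega)
  have hpe : Even (p - 1) := by
    obtain ⟨c, rfl⟩ := hpodd
    simp
  set T := n / (p - 1) with hT
  have hTn : (p - 1) * T ≤ n := Nat.mul_div_le _ _
  have hbound : ∀ r ≤ p - 1, ∀ k < T, r + (p - 1) * k ≤ n := by
    intro r hr k hk
    have : (p - 1) * (k + 1) ≤ (p - 1) * T := Nat.mul_le_mul_left _ hk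
    rw [mul_add] at this
    omega
  have hfermat : ∀ r k : ℕ, (p : ℤ) ∣ 3 ^ (r + (p - 1) * k) - 3 ^ r := by
    intro r k
    rw [← ZMod.intCast_zmod_eq_zero_iff_dvd]
    push_cast
    rw [pow_add, pow_mul, ZMod.pow_card_sub_one_eq_one (three_zmod_ne_zero hp hp5), one_pow,
      mul_one, sub_self]
  have hinj : ∀ r : ℕ, Function.Injective fun k : ℕ => r + (p - 1) * k := by
    intro r x y hxy
    exact Nat.eq_of_mul_eq_mul_left (show 0 < p - 1 by omega) (Nat.add_left_cancel hxy)
  have heven : ∀ k, Even (i + (p - 1) * k) := fun k => hie.add (hpe.mul_right k)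
  have hodd : ∀ k, Odd (j + (p - 1) * k) := fun k => hjo.add_even (hpe.mul_right k)
  have hcard := h.card_le_of_dvd hq hp hp5
    ((Finset.range T).image (fun k => i + (p - 1) * k) ∪
      (Finset.range T).image (fun k => j + (p - 1) * k)) (3 ^ i - qStar q) (by
      intro l hl
      rw [Finset.mem_union, Finset.mem_image, Finset.mem_image] at hl
      rcases hl with ⟨k, hk, rfl⟩ | ⟨k, hk, rfl⟩
      · refine ⟨by omega, hbound i hip k (Finset.mem_range.1 hk), ?_⟩
        rw [(heven k).neg_one_pow]
        simpa using hfermat i k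
      · refine ⟨by omega, hbound j hjp k (Finset.mem_range.1 hk), ?_⟩
        rw [(hodd k).neg_one_pow]
        have := dvd_sub (hfermat j k) hd
        have he : (3 : ℤ) ^ (j + (p - 1) * k) - 3 ^ j - (3 ^ i - 3 ^ j - 2 * qStar q) =
            3 ^ (j + (p - 1) * k) - qStar q * -1 - (3 ^ i - qStar q) := by ring
        rwa [he] at this)
  have hdisj : Disjoint ((Finset.range T).image (fun k => i + (p - 1) * k))
      ((Finset.range T).image (fun k => j + (p - 1) * k)) := by
    rw [Finset.disjoint_left]
    intro l hl hl'
    obtain ⟨k, -, rfl⟩ := Finset.mem_image.1 hl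
    obtain ⟨k', -, hk'⟩ := Finset.mem_image.1 hl'
    exact Nat.not_even_iff_odd.2 (hodd k') (hk' ▸ heven k)
  rw [Finset.card_union_of_disjoint hdisj, Finset.card_image_of_injective _ (hinj i),
    Finset.card_image_of_injective _ (hinj j), Finset.card_range] at hcard
  have hle : p ≤ p ^ b := Nat.le_self_pow (by omega) p
  obtain ⟨c, hc⟩ : Odd (p ^ b) := hpodd.pow
  have hTc : c + 1 ≤ T := by
    rw [hT, Nat.le_div_iff_mul_le (by omega)]
    rw [pow_succ', hc] at hn
    obtain ⟨s, rfl⟩ : ∃ s, p = s + 1 := ⟨p - 1, by omega⟩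
    rw [Nat.add_sub_cancel]
    nlinarith
  omega

theorem exists_sq_sub_three_mul_sq {p : ℕ} (hp : p.Prime) (hp5 : 5 ≤ p) {d : ZMod p}
    (hd : d ≠ 0) : ∃ x y : ZMod p, x ≠ 0 ∧ y ≠ 0 ∧ x ^ 2 - 3 * y ^ 2 = d := by
  have : Fact p.Prime := ⟨hp⟩
  have h2 := two_zmod_ne_zero hp hp5
  have h3 := three_zmod_ne_zero hp hp5
  obtain ⟨x, y, hxy⟩ : ∃ x y : ZMod p, x ^ 2 - 3 * y ^ 2 = d := by
    have hdeg1 : (Polynomial.X ^ 2 - Polynomial.C d : Polynomial (ZMod p)).degree = 2 :=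
      Polynomial.degree_X_pow_sub_C (by norm_num) d
    have hdeg2 : (Polynomial.C (-3) * Polynomial.X ^ 2 : Polynomial (ZMod p)).degree = 2 :=
      Polynomial.degree_C_mul_X_pow 2 (neg_ne_zero.2 h3)
    obtain ⟨a, b, hab⟩ := FiniteField.exists_root_sum_quadratic hdeg1 hdeg2 (by
      rw [ZMod.card]
      exact Nat.odd_iff.1 (hp.odd_of_ne_two (by omega)))
    refine ⟨a, b, ?_⟩
    simp only [Polynomial.eval_sub, Polynomial.eval_pow, Polynomial.eval_X, Polynomial.eval_C,
      Polynomial.eval_mul] at hab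
    linear_combination hab
  -- `1 = 2 ^ 2 - 3 * 1 ^ 2` and `-3 = 3 ^ 2 - 3 * 2 ^ 2` remove a vanishing coordinate
  by_cases hx : x = 0
  · subst hx
    have hy : y ≠ 0 := by
      rintro rfl
      exact hd (by rw [← hxy]; ring)
    exact ⟨3 * y, 2 * y, mul_ne_zero h3 hy, mul_ne_zero h2 hy, by rw [← hxy]; ring⟩
  · by_cases hy : y = 0
    · subst hy
      exact ⟨2 * x, x, mul_ne_zero h2 hx, hx, by rw [← hxy]; ring⟩
    · exact ⟨x, y, hx, hy, hxy⟩

theorem exists_pow_nine_eq_sq {p : ℕ} (hp : p.Prime) (hp5 : 5 ≤ p)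
    (h9 : IsPrimitiveRoot (9 : ZMod p) ((p - 1) / 2)) {x : ZMod p} (hx : x ≠ 0) :
    ∃ i < (p - 1) / 2, (9 : ZMod p) ^ i = x ^ 2 := by
  have : Fact p.Prime := ⟨hp⟩
  have : NeZero ((p - 1) / 2) := ⟨by omega⟩
  refine h9.eq_pow_of_pow_eq_one ?_
  rw [← pow_mul, two_mul_half_pred_eq hp hp5]
  exact ZMod.pow_card_sub_one_eq_one hx

/-- The modulus is not a higher power of a prime `p ≠ q`: as `9` generates the squares modulo `p`,
a representation `2 q* = x ^ 2 - 3 y ^ 2` is a collision modulo `p`, which lifts. -/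
theorem Discriminates.eq_zero_of_ne {q n p b : ℕ} (hq : Odd q) (hp : p.Prime) (hp5 : 5 ≤ p)
    (hpq : (qStar q : ZMod p) ≠ 0) (h : Discriminates (browkinSalajan q) n (p ^ (b + 1)))
    (hn : p ^ (b + 1) < 2 * n) : b = 0 := by
  by_contra hb
  have : Fact p.Prime := ⟨hp⟩
  have h9 := h.isPrimitiveRoot_nine hq hp hp5 hn
  obtain ⟨x, y, hx, hy, hxy⟩ := exists_sq_sub_three_mul_sq hp hp5
    (mul_ne_zero (two_zmod_ne_zero hp hp5) hpq)
  obtain ⟨i, hi, hix⟩ := exists_pow_nine_eq_sq hp hp5 h9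
    (x := x / 3) (div_ne_zero hx (three_zmod_ne_zero hp hp5))
  obtain ⟨j, hj, hjy⟩ := exists_pow_nine_eq_sq hp hp5 h9 hy
  have hh := two_mul_half_pred_eq hp hp5
  refine h.not_dvd_of_higher_pow (i := 2 * (i + 1)) (j := 2 * j + 1) hq hp hp5 (by omega) hn
    (by omega) (by omega) (by omega) (by omega) (even_two_mul _) ⟨j, rfl⟩ ?_
  rw [← ZMod.intCast_zmod_eq_zero_iff_dvd]
  push_cast
  have h3 := three_zmod_ne_zero hp hp5
  rw [pow_succ _ (2 * j), pow_mul, pow_mul, show (3 : ZMod p) ^ 2 = 9 by norm_num, pow_succ, hix,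
    hjy, ← hxy]
  field_simp
  ring

theorem Discriminates.eq_seven_of_ne {q n p k : ℕ} (hq : Odd q) (hp : p.Prime) (hp5 : 5 ≤ p)
    (hpq : (qStar q : ZMod p) ≠ 0) (h : Discriminates (browkinSalajan q) n p)
    (hk : 2 ^ k < n) (hpk : p < 2 ^ (k + 1)) :
    p = 7 ∧ n = 5 ∧ qStar q ≡ 1 [ZMOD 7] := by
  have : Fact p.Prime := ⟨hp⟩
  have hpodd : Odd p := hp.odd_of_ne_two (by omega)
  have hnp := h.le hp.pos
  have hn : p ^ (0 + 1) < 2 * n := by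
    rw [pow_succ] at hpk
    rw [zero_add, pow_one]
    omega
  have h9 := Discriminates.isPrimitiveRoot_nine (b := 0) hq hp hp5 (by simpa using h) hn
  have hh := two_mul_half_pred_eq hp hp5
  by_cases hp7 : p = 7
  · subst hp7
    have hk2 : k = 2 := by
      have h1 : 2 < k + 1 :=
        (Nat.pow_lt_pow_iff_right (a := 2) (by norm_num)).1 (by omega)
      have h2 : k < 3 := (Nat.pow_lt_pow_iff_right (a := 2) (by norm_num)).1 (by omega)
      omega
    subst hk2
    have hn6 : n < 1 + 6 := h.lt_add_of_dvd hq le_rfl (by norm_num) (by decide) (by norm_num)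
    have h0 : ¬ (7 : ℤ) ∣ qStar q := by
      rwa [Ne, ZMod.intCast_zmod_eq_zero_iff_dvd] at hpq
    have key : ∀ i j : ℕ, 1 ≤ i → i ≤ n → 1 ≤ j → j ≤ n → Even i → Odd j →
        ¬ (7 : ℤ) ∣ 3 ^ i - 3 ^ j - 2 * qStar q := fun i j h1 h2 h3 h4 h5 h6 =>
      h.not_dvd_even_sub_odd hq hpodd h1 h2 h3 h4 h5 h6
    have k1 := key 2 1 (by omega) (by omega) (by omega) (by omega) (by decide) (by decide)
    have k2 := key 2 3 (by omega) (by omega) (by omega) (by omega) (by decide) (by decide)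
    have k3 := key 2 5 (by omega) (by omega) (by omega) (by omega) (by decide) (by decide)
    have k4 := key 4 1 (by omega) (by omega) (by omega) (by omega) (by decide) (by decide)
    have k5 := key 4 3 (by omega) (by omega) (by omega) (by omega) (by decide) (by decide)
    norm_num at k1 k2 k3 k4 k5
    have h1 : qStar q % 7 = 1 := by
      have hr : 0 ≤ qStar q % 7 ∧ qStar q % 7 < 7 := by omega
      generalize hr' : qStar q % 7 = r at hr ⊢
      obtain ⟨hr0, hr7⟩ := hr
      interval_cases r <;> omega
    refine ⟨rfl, ?_, h1⟩
    by_contra hn5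
    have k6 := key 6 3 (by omega) (by omega) (by omega) (by omega) (by decide) (by decide)
    norm_num at k6
    omega
  · exfalso
    obtain ⟨i, j, hi1, hi2, hj, hij⟩ := exists_pow_nine_sub hp hp5 hp7 (hk.trans_le hnp) hpk
      (fun l h0 hl => h9.pow_ne_one_of_pos_of_lt (by omega) (by
        have := hk.trans_le hnp
        omega)) (mul_ne_zero (two_zmod_ne_zero hp hp5) hpq)
    refine h.not_dvd_even_sub_odd (i := 2 * i) (j := 2 * j + 1) hq hpodd (by omega) (by omega)
      (by omega) (by omega) (even_two_mul _) ⟨j, rfl⟩ ?_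
    rw [← ZMod.intCast_zmod_eq_zero_iff_dvd]
    push_cast
    rw [pow_succ _ (2 * j), pow_mul, pow_mul, show (3 : ZMod p) ^ 2 = 9 by norm_num, ← hij]
    ring

theorem dvd_qStar_self (q : ℕ) : (q : ℤ) ∣ qStar q := Dvd.intro_left _ rfl

theorem qStar_ne_zero_of_ne {p q : ℕ} (hp : p.Prime) (hq : q.Prime) (hpq : p ≠ q) :
    (qStar q : ZMod p) ≠ 0 := by
  have : Fact p.Prime := ⟨hp⟩
  rw [qStar]
  push_cast
  refine mul_ne_zero (pow_ne_zero _ (neg_ne_zero.2 one_ne_zero)) ?_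
  exact natCast_zmod_ne_zero ((Nat.coprime_primes hq hp).2 hpq.symm) hp

/-- If a power of `q` separates more terms than half of it, then `3` is not a square modulo `q`:
otherwise `3 ^ i ≡ 3 ^ j` modulo `q` for some even `i` and odd `j`, and `q` divides `q*`. -/
theorem Discriminates.isPrimitiveRoot_three {q n b : ℕ} (hq : q.Prime) (hq5 : 5 ≤ q)
    (h : Discriminates (browkinSalajan q) n (q ^ (b + 1))) (hn : q ^ (b + 1) < 2 * n) :
    IsPrimitiveRoot (3 : ZMod q) (q - 1) := by
  have : Fact q.Prime := ⟨hq⟩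
  have hqodd : Odd q := hq.odd_of_ne_two (by omega)
  have h3 := three_zmod_ne_zero hq hq5
  have h9 := h.isPrimitiveRoot_nine hqodd hq hq5 hn
  have hh := two_mul_half_pred_eq hq hq5
  have hodd : ∀ l : ℕ, 2 * l + 1 < q - 1 → (3 : ZMod q) ^ (2 * l + 1) ≠ 1 := by
    intro l hl h1
    have hd : (q : ℤ) ∣ 3 ^ (2 * (l + 1)) - 3 ^ 1 - 2 * qStar q := by
      refine dvd_sub ?_ ((dvd_qStar_self q).mul_left 2)
      rw [← ZMod.intCast_zmod_eq_zero_iff_dvd]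
      push_cast
      rw [show 2 * (l + 1) = (2 * l + 1) + 1 by ring, pow_succ, h1]
      ring
    rcases Nat.eq_zero_or_pos b with rfl | hb
    · -- an exponent `2 l + 1 ≤ (q - 1) / 2` makes the indices `1` and `2 l + 2` collide
      have hl' : 2 * l + 1 ≤ (q - 1) / 2 ∨ (q - 1) / 2 < 2 * l + 1 := le_or_gt _ _
      rw [zero_add, pow_one] at hn h
      rcases hl' with hle | hgt
      · refine h.not_dvd_even_sub_odd (i := 2 * (l + 1)) (j := 1) hqodd hqodd (by omega) (by omega)
          le_rfl (by omega) (even_two_mul _) odd_one hd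
      · -- `9 ^ (2 l + 1 - (q - 1) / 2) = 1`, with an exponent below the order of `9`
        refine h9.pow_ne_one_of_pos_of_lt (l := 2 * l + 1 - (q - 1) / 2) (by omega) (by omega) ?_
        have e1 : (9 : ZMod q) ^ (2 * l + 1) = 1 := by
          rw [show (9 : ZMod q) = 3 ^ 2 by norm_num, ← pow_mul, mul_comm, pow_mul, h1, one_pow]
        have e2 := h9.pow_eq_one
        rw [← Nat.sub_add_cancel hgt.le, pow_add, e2, mul_one] at e1
        exact e1
    · exact h.not_dvd_of_higher_pow hqodd hq hq5 hb hn (by omega) (by omega) le_rfl (by omega)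
        (even_two_mul _) odd_one hd
  refine IsPrimitiveRoot.mk_of_lt _ (by omega) (ZMod.pow_card_sub_one_eq_one h3) ?_
  intro l hl0 hl h1
  rcases Nat.even_or_odd' l with ⟨c, rfl | rfl⟩
  · rw [pow_mul, show (3 : ZMod q) ^ 2 = 9 by norm_num] at h1
    exact h9.pow_ne_one_of_pos_of_lt (by omega) (by omega) h1
  · exact hodd c hl h1

theorem four_mul_dvd_of_mirimanoff {q b : ℕ} (hq5 : 5 ≤ q) (h : IsMirimanoffPrime q) :
    ((4 * (q ^ (b + 2) : ℕ)) : ℤ) ∣ 3 ^ ((q - 1) * q ^ b) - 1 := by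
  have hqodd : Odd q := h.1.odd_of_ne_two (by omega)
  have heven : Even ((q - 1) * q ^ b) := by
    obtain ⟨c, rfl⟩ := hqodd
    simp
  refine four_mul_dvd_three_pow_sub_one hqodd.pow heven ?_
  have h1 : ((q ^ 2 : ℕ) : ℤ) ∣ 3 ^ (q - 1) - 1 := by
    exact_mod_cast Nat.modEq_iff_dvd.1 h.2.symm
  obtain ⟨c, hc⟩ := h1
  induction b with
  | zero => exact ⟨c, by simpa using hc⟩
  | succ b ih =>
    have ih' := ih (by
      obtain ⟨c, rfl⟩ := hqodd
      simp)
    -- raising `3 ^ ((q - 1) q ^ b) ≡ 1` modulo `q ^ (b + 2)` to the power `q` gains a factor `q`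
    set y : ℤ := 3 ^ ((q - 1) * q ^ b) with hy
    have hy1 : (3 : ℤ) ^ ((q - 1) * q ^ (b + 1)) = y ^ q := by
      rw [hy, ← pow_mul]
      congr 1
      ring
    have hgeom : (q : ℤ) ∣ ∑ i ∈ Finset.range q, y ^ i := by
      have hqy : y ≡ 1 [ZMOD q] := by
        refine (Int.modEq_iff_dvd.2 ((Dvd.intro_left (q ^ (b + 1) : ℤ) ?_).trans ih')).symm
        push_cast
        ring
      rw [← Int.modEq_zero_iff_dvd]
      have : ∑ i ∈ Finset.range q, y ^ i ≡ ∑ i ∈ Finset.range q, 1 [ZMOD q] := by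
        refine Int.ModEq.sum fun i _ => ?_
        simpa using hqy.pow i
      refine this.trans ?_
      simp
    rw [hy1, ← mul_geom_sum, pow_succ]
    push_cast at ih' ⊢
    exact mul_dvd_mul ih' hgeom

/-- A modulus that separates the first `n` terms and lies strictly below the least power of `2`
that is at least `n` is a power of `q`, apart from the modulus `7` for `n = 5`. -/
theorem Discriminates.classification {q n m k : ℕ} (hq : q.Prime) (hq5 : 5 ≤ q)
    (h : Discriminates (browkinSalajan q) n m) (hm : 0 < m) (hk : 2 ^ k < n)
    (hmk : m < 2 ^ (k + 1)) :
    (∃ b, m = q ^ (b + 1) ∧ IsArtinPrime q ∧ n ≤ (q - 1) * q ^ b ∧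
      (IsMirimanoffPrime q → b = 0)) ∨
    (m = 7 ∧ n = 5 ∧ q ≠ 7 ∧ qStar q ≡ 1 [ZMOD 7]) := by
  have hqodd : Odd q := hq.odd_of_ne_two (by omega)
  obtain ⟨p, b, hp, hp5, hb, rfl⟩ := h.exists_prime_pow hqodd hm hk hmk
  obtain ⟨b, rfl⟩ : ∃ c, b = c + 1 := ⟨b - 1, by omega⟩
  have hn : p ^ (b + 1) < 2 * n := by
    rw [pow_succ 2] at hmk
    omega
  by_cases hpq : p = q
  · subst hpq
    left
    have hprim := h.isPrimitiveRoot_three hp hp5 hn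
    have hpos : 0 < p - 1 := by omega
    have he1 : Even (p - 1) := by
      obtain ⟨c, rfl⟩ := hqodd
      simp
    refine ⟨b, rfl, ⟨hp, hprim⟩, ?_, ?_⟩
    · have hd : (p : ℤ) ∣ 3 ^ (p - 1) - 1 := by
        rw [← ZMod.intCast_zmod_eq_zero_iff_dvd]
        push_cast
        rw [hprim.pow_eq_one, sub_self]
      have := h.lt_add_of_dvd hqodd le_rfl (Nat.mul_pos hpos (pow_pos hp.pos b))
        (he1.mul_right _) ((four_mul_dvd_three_pow_sub_one hqodd.pow (he1.mul_right _)
          (pow_succ_dvd_three_pow_sub_one b hd)).mul_left _)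
      omega
    · intro hmir
      by_contra hb0
      obtain ⟨c, rfl⟩ : ∃ c, b = c + 1 := ⟨b - 1, by omega⟩
      have hlt := h.lt_add_of_dvd hqodd le_rfl (Nat.mul_pos hpos (pow_pos hp.pos c))
        (he1.mul_right _) ((four_mul_dvd_of_mirimanoff hp5 hmir).mul_left _)
      have h1 : (p - 1) * p ^ c ≤ p * p ^ c := Nat.mul_le_mul_right _ (by omega)
      have h2 : p * p ^ c * 5 ≤ p * p ^ c * p := Nat.mul_le_mul_left _ hp5
      rw [show p ^ (c + 1 + 1) = p * p ^ c * p by ring] at hn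
      have h3 : 0 < p * p ^ c := Nat.mul_pos hp.pos (pow_pos hp.pos c)
      omega
  · right
    have hne := qStar_ne_zero_of_ne hp hq hpq
    obtain rfl := h.eq_zero_of_ne hqodd hp hp5 hne hn
    rw [zero_add, pow_one] at h hmk ⊢
    obtain ⟨h7, h5, h1⟩ := h.eq_seven_of_ne hqodd hp hp5 hne hk hmk
    exact ⟨h7, h5, fun hq7 => hpq (h7.trans hq7.symm), h1⟩

/-! ### Moduli that do separate the first `n` terms -/

/-- The parity of the terms alternates, and for even `t` the `2`-adic valuation of `3 ^ t - 1`
exceeds that of `t` by `2`. -/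
theorem discriminates_two_pow {q n e : ℕ} (hq : Odd q) (hn : n ≤ 2 ^ e) :
    Discriminates (browkinSalajan q) n (2 ^ e) := by
  intro i j hi hij hj hc
  rw [browkinSalajan_modEq_iff hq] at hc
  have he : e ≠ 0 := by
    rintro rfl
    rw [pow_zero] at hn
    omega
  have h8 : (8 : ℤ) ∣ 4 * (2 ^ e : ℕ) := by
    obtain ⟨c, rfl⟩ := Nat.exists_eq_succ_of_ne_zero he
    refine ⟨2 ^ c, ?_⟩
    push_cast
    rw [pow_succ]
    ring
  have hQ := qStar_emod_four hq
  have hev : ∀ x : ℕ, Even x → (3 : ℤ) ^ x % 8 = 1 := by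
    rintro x ⟨y, rfl⟩
    have : (3 : ℤ) ^ (y + y) ≡ 1 [ZMOD 8] := by
      rw [← two_mul, pow_mul]
      simpa using (show (3 : ℤ) ^ 2 ≡ 1 [ZMOD 8] by decide).pow y
    exact this
  have hod : ∀ x : ℕ, Odd x → (3 : ℤ) ^ x % 8 = 3 := by
    rintro x ⟨y, rfl⟩
    have h1 := hev (2 * y) (even_two_mul y)
    rw [pow_succ]
    omega
  have h8c := h8.trans hc
  obtain ⟨t, rfl⟩ : ∃ t, j = i + t := ⟨j - i, by omega⟩
  -- terms of opposite parity of the index are incongruent modulo `2`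
  have ht : Even t := by
    by_contra ht
    rw [Nat.not_even_iff_odd] at ht
    rcases Nat.even_or_odd i with hie | hio
    · have hj' := hie.add_odd ht
      have := hev i hie
      have := hod _ hj'
      rw [hie.neg_one_pow, hj'.neg_one_pow] at h8c
      omega
    · have hj' := hio.add_odd ht
      have := hod i hio
      have := hev _ hj'
      rw [hio.neg_one_pow, hj'.neg_one_pow] at h8c
      omega
  have hd : (2 : ℤ) ^ (e + 2) ∣ 3 ^ i * (3 ^ t - 1) := by
    have h1 : (3 ^ (i + t) - qStar q * (-1) ^ (i + t)) - (3 ^ i - qStar q * (-1) ^ i)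
        = (3 : ℤ) ^ i * (3 ^ t - 1) := by
      rw [pow_add (-1 : ℤ), ht.neg_one_pow, pow_add]
      ring
    have h2 : (4 : ℤ) * (2 ^ e : ℕ) = 2 ^ (e + 2) := by
      push_cast
      ring
    rwa [h1, h2] at hc
  have hcop : IsCoprime ((2 : ℤ) ^ (e + 2)) (3 ^ i) :=
    IsCoprime.pow (by exact_mod_cast Nat.isCoprime_iff_coprime.2 (show Nat.Coprime 2 3 by decide))
  have hd' := hcop.dvd_of_dvd_mul_left hd
  have hdn : 2 ^ (e + 2) ∣ 3 ^ t - 1 ^ t := by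
    have h3 : 1 ≤ 3 ^ t := Nat.one_le_pow _ _ (by norm_num)
    rw [one_pow]
    zify [h3]
    exact hd'
  have hval := padicValNat.pow_two_sub_pow (n := t) (x := 3) (y := 1) (by norm_num) (by norm_num)
    (by norm_num) (by omega) ht
  have h31 : 3 ^ t - 1 ^ t ≠ 0 := by
    have : 1 < 3 ^ t := Nat.one_lt_pow (by omega) (by norm_num)
    rw [one_pow]
    omega
  have v4 : padicValNat 2 (3 + 1) = 2 := by
    rw [show 3 + 1 = 2 ^ 2 by norm_num, padicValNat.prime_pow]
  have v2 : padicValNat 2 (3 - 1) = 1 := by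
    rw [show 3 - 1 = 2 by norm_num, padicValNat_self]
  rw [padicValNat_dvd_iff_le h31] at hdn
  have hte : 2 ^ e ∣ t := by
    rw [padicValNat_dvd_iff_le (by omega)]
    omega
  have := Nat.le_of_dvd (by omega) hte
  omega

/-- A collision modulo `q` forces `j - i = (q - 1) s`, so that both indices have the same parity;
then lifting the exponent gives `q ^ b ∣ s`. -/
theorem discriminates_prime_pow {q n b : ℕ} (hq5 : 5 ≤ q) (hA : IsArtinPrime q)
    (hM : IsMirimanoffPrime q → b = 0) (hn : n ≤ (q - 1) * q ^ b) :
    Discriminates (browkinSalajan q) n (q ^ (b + 1)) := by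
  obtain ⟨hq, h3⟩ := hA
  have : Fact q.Prime := ⟨hq⟩
  have hodd : Odd q := hq.odd_of_ne_two (by omega)
  intro i j hi hij hj hc
  rw [browkinSalajan_modEq_iff hodd] at hc
  have hc := (Dvd.intro_left (4 : ℤ) rfl).trans hc
  obtain ⟨t, rfl⟩ : ∃ t, j = i + t := ⟨j - i, by omega⟩
  have h30 := three_zmod_ne_zero hq hq5
  have hqt : q - 1 ∣ t := by
    rw [← h3.pow_eq_one_iff_dvd]
    have h1 : (q : ℤ) ∣ (q ^ (b + 1) : ℕ) := by
      rw [pow_succ]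
      exact_mod_cast Dvd.intro_left _ rfl
    have h2 := (ZMod.intCast_zmod_eq_zero_iff_dvd _ q).2 (h1.trans hc)
    have hQ : (qStar q : ZMod q) = 0 :=
      (ZMod.intCast_zmod_eq_zero_iff_dvd _ q).2 (dvd_qStar_self q)
    push_cast at h2
    rw [hQ, zero_mul, zero_mul, sub_zero, sub_zero, pow_add, ← mul_sub_one] at h2
    exact sub_eq_zero.1 ((mul_eq_zero.1 h2).resolve_left (pow_ne_zero _ h30))
  have hqe : Even (q - 1) := by
    obtain ⟨c, rfl⟩ := hodd
    simp
  have ht : Even t := (even_iff_two_dvd.1 hqe |>.trans hqt) |> even_iff_two_dvd.2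
  have h1 : (3 ^ (i + t) - qStar q * (-1) ^ (i + t)) - (3 ^ i - qStar q * (-1) ^ i)
      = (3 : ℤ) ^ i * (3 ^ t - 1) := by
    rw [pow_add (-1 : ℤ), ht.neg_one_pow, pow_add]
    ring
  rw [h1] at hc
  have hq3 : Nat.Coprime q 3 := (Nat.coprime_primes hq Nat.prime_three).2 (by omega)
  have hcop : IsCoprime ((q ^ (b + 1) : ℕ) : ℤ) (3 ^ i) := by
    have : Nat.Coprime (q ^ (b + 1)) (3 ^ i) := hq3.pow _ _
    exact_mod_cast Nat.isCoprime_iff_coprime.2 this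
  have hd' := hcop.dvd_of_dvd_mul_left hc
  obtain ⟨s, rfl⟩ := hqt
  have hs : s ≠ 0 := by
    rintro rfl
    omega
  have hq1 : 1 < 3 ^ (q - 1) := Nat.one_lt_pow (by omega) (by norm_num)
  have hdn : q ^ (b + 1) ∣ (3 ^ (q - 1)) ^ s - 1 ^ s := by
    have h3 : 1 ≤ (3 ^ (q - 1)) ^ s := Nat.one_le_pow _ _ (by omega)
    rw [one_pow]
    zify [h3]
    rw [pow_mul] at hd'
    exact_mod_cast hd'
  have hqd : q ∣ 3 ^ (q - 1) - 1 := by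
    rw [← ZMod.natCast_eq_zero_iff, Nat.cast_sub hq1.le]
    push_cast
    rw [h3.pow_eq_one, sub_self]
  have hval := padicValNat.pow_sub_pow (p := q) hodd (x := 3 ^ (q - 1)) (y := 1) hq1 hqd
    (by
      intro h
      have := (Nat.prime_dvd_prime_iff_eq hq Nat.prime_three).1 (hq.dvd_of_dvd_pow h)
      omega) hs
  have hne : (3 ^ (q - 1)) ^ s - 1 ^ s ≠ 0 := by
    have : 1 < (3 ^ (q - 1)) ^ s := Nat.one_lt_pow hs hq1
    rw [one_pow]
    omega
  rw [padicValNat_dvd_iff_le hne] at hdn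
  have hqs : q ^ b ∣ s := by
    by_cases hb : b = 0
    · rw [hb, pow_zero]
      exact one_dvd s
    rw [padicValNat_dvd_iff_le hs]
    -- `q` divides `3 ^ (q - 1) - 1` exactly once
    have : padicValNat q (3 ^ (q - 1) - 1) < 2 := by
      by_contra! h2
      rw [← padicValNat_dvd_iff_le (by omega)] at h2
      refine hb (hM ⟨hq, ?_⟩)
      exact ((Nat.modEq_iff_dvd' hq1.le).2 h2).symm
    omega
  have := Nat.mul_le_mul_left (q - 1) (Nat.le_of_dvd (by omega) hqs)
  omega

theorem discriminates_five_seven {q : ℕ} (hq : Odd q) (h : qStar q ≡ 1 [ZMOD 7]) :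
    Discriminates (browkinSalajan q) 5 7 := by
  intro i j hi hij hj hc
  rw [browkinSalajan_modEq_iff hq] at hc
  have hQ : qStar q % 7 = 1 := h
  have hc := (Dvd.intro_left (4 : ℤ) rfl).trans hc
  generalize qStar q = Q at *
  interval_cases j <;> interval_cases i <;> norm_num at hc <;> omega

/-! ### The values of the discriminator -/

theorem browkinD_isLeast {q : ℕ} (hq : Odd q) (n : ℕ) :
    IsLeast {m : ℕ | 0 < m ∧ Discriminates (browkinSalajan q) n m} (browkinD q n) := by
  refine discriminator_isLeast _ n fun i hi j hj hij => ?_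
  have h := discriminates_two_pow hq (n := n) (e := n) Nat.lt_two_pow_self.le
  rcases lt_trichotomy i j with hlt | heq | hlt
  · exact absurd (by rw [hij]) (h i j hi.1 hlt hj.2)
  · exact heq
  · exact absurd (by rw [hij]) (h j i hj.1 hlt hi.2)

theorem le_browkinD {q : ℕ} (hq : Odd q) (n : ℕ) : n ≤ browkinD q n :=
  (browkinD_isLeast hq n).1.2.le (browkinD_isLeast hq n).1.1

theorem browkinD_le_two_pow {q n e : ℕ} (hq : Odd q) (hn : n ≤ 2 ^ e) : browkinD q n ≤ 2 ^ e :=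
  (browkinD_isLeast hq n).2 ⟨by positivity, discriminates_two_pow hq hn⟩

theorem browkinD_le_prime_pow {q n b : ℕ} (hq5 : 5 ≤ q) (hA : IsArtinPrime q)
    (hM : IsMirimanoffPrime q → b = 0) (hn : n ≤ (q - 1) * q ^ b) :
    browkinD q n ≤ q ^ (b + 1) :=
  (browkinD_isLeast (hA.1.odd_of_ne_two (by omega)) n).2
    ⟨pow_pos hA.1.pos _, discriminates_prime_pow hq5 hA hM hn⟩

theorem browkinD_cases {q n : ℕ} (hq : q.Prime) (hq5 : 5 ≤ q) (hn : 1 ≤ n) :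
    (∃ e, browkinD q n = 2 ^ e ∧ n ≤ 2 ^ e) ∨
    (∃ b, browkinD q n = q ^ (b + 1) ∧ IsArtinPrime q ∧ n ≤ (q - 1) * q ^ b ∧
      (IsMirimanoffPrime q → b = 0)) ∨
    (browkinD q n = 7 ∧ n = 5 ∧ q ≠ 7 ∧ qStar q ≡ 1 [ZMOD 7]) := by
  have hodd : Odd q := hq.odd_of_ne_two (by omega)
  have hle : n ≤ 2 ^ Nat.clog 2 n := Nat.le_pow_clog (by norm_num) n
  rcases (browkinD_le_two_pow hodd hle).eq_or_lt with heq | hlt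
  · exact Or.inl ⟨_, heq, hle⟩
  · right
    obtain ⟨hpos, hdis⟩ := (browkinD_isLeast hodd n).1
    have hn1 : 1 < n := by
      by_contra! h
      obtain rfl : n = 1 := by omega
      rw [Nat.clog_one_right, pow_zero] at hlt
      omega
    have hlog : 0 < Nat.clog 2 n := Nat.clog_pos (by norm_num) hn1
    have hlt' : 2 ^ (Nat.clog 2 n).pred < n := Nat.pow_pred_clog_lt_self (by norm_num) hn1
    exact hdis.classification hq hq5 hpos hlt' (by rwa [Nat.pred_eq_sub_one,
      Nat.sub_add_cancel hlog])

theorem two_pow_ne_prime_pow {q : ℕ} (hq : Odd q) (hq5 : 5 ≤ q) (e b : ℕ) :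
    2 ^ e ≠ q ^ (b + 1) := by
  intro h
  have h1 : Odd (q ^ (b + 1)) := hq.pow
  have h2 : 5 ≤ q ^ (b + 1) := hq5.trans (Nat.le_self_pow (by omega) q)
  rw [← h] at h1 h2
  rcases Nat.eq_zero_or_pos e with rfl | he
  · norm_num at h2
  · exact Nat.not_even_iff_odd.2 h1 (Nat.even_pow.2 ⟨even_two, by omega⟩)

theorem browkinD_eq_prime_pow {q n b : ℕ} (hq : q.Prime) (hq5 : 5 ≤ q) (hn : 1 ≤ n)
    (h : browkinD q n = q ^ (b + 1)) :
    IsArtinPrime q ∧ n ≤ (q - 1) * q ^ b ∧ (IsMirimanoffPrime q → b = 0) ∧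
      ∀ e, n ≤ 2 ^ e → q ^ (b + 1) < 2 ^ e := by
  have hodd : Odd q := hq.odd_of_ne_two (by omega)
  have hlast : ∀ e, n ≤ 2 ^ e → q ^ (b + 1) < 2 ^ e := fun e he =>
    lt_of_le_of_ne (h ▸ browkinD_le_two_pow hodd he) (two_pow_ne_prime_pow hodd hq5 e b).symm
  rcases browkinD_cases hq hq5 hn with ⟨e, he, -⟩ | ⟨c, hc, hA, hnc, hM⟩ | ⟨h7, -, hq7, -⟩
  · exact absurd (he.symm.trans h) (two_pow_ne_prime_pow hodd hq5 e b)
  · have hbc : b + 1 = c + 1 := Nat.pow_right_injective hq.two_le (h.symm.trans hc)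
    obtain rfl : b = c := by omega
    exact ⟨hA, hnc, hM, hlast⟩
  · have : q ∣ 7 := by
      rw [← h7, h, pow_succ]
      exact Dvd.intro_left _ rfl
    exact absurd ((Nat.prime_dvd_prime_iff_eq hq (by norm_num)).1 this) hq7

theorem qStar_modEq_one_iff {q : ℕ} (hq : Odd q) :
    qStar q ≡ 1 [ZMOD 7] ↔ ((q : ℤ) ≡ 1 [ZMOD 28] ∨ (q : ℤ) ≡ -1 [ZMOD 28]) := by
  obtain ⟨k, rfl⟩ := hq
  have h : (2 * k + 1 - 1) / 2 = k := by omega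
  rw [qStar, h]
  unfold Int.ModEq
  rcases Nat.even_or_odd k with hk | hk
  · rw [hk.neg_one_pow]
    obtain ⟨l, rfl⟩ := hk
    push_cast
    omega
  · rw [hk.neg_one_pow]
    obtain ⟨l, rfl⟩ := hk
    push_cast
    omega

theorem div_mul_le_pow_iff {q n f : ℕ} (hq5 : 5 ≤ q) (hn : 1 ≤ n) :
    (q : ℝ) / ((q : ℝ) - 1) * (n : ℝ) ≤ (q : ℝ) ^ f ↔ ∃ b, f = b + 1 ∧ n ≤ (q - 1) * q ^ b := by
  have hq0 : (5 : ℝ) ≤ q := by exact_mod_cast hq5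
  have hn0 : (1 : ℝ) ≤ n := by exact_mod_cast hn
  rw [div_mul_eq_mul_div, div_le_iff₀ (by linarith)]
  rcases f with _ | b
  · constructor
    · intro h
      rw [pow_zero, one_mul] at h
      nlinarith
    · rintro ⟨b, hb, -⟩
      omega
  · rw [pow_succ, mul_comm (_ ^ b) (q : ℝ), mul_assoc, mul_le_mul_iff_right₀ (by linarith)]
    have hcast : (((q - 1) * q ^ b : ℕ) : ℝ) = q ^ b * (q - 1) := by
      rw [Nat.cast_mul, Nat.cast_sub (by omega)]
      push_cast
      ring
    rw [← hcast, Nat.cast_le]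
    constructor
    · exact fun h => ⟨b, rfl, h⟩
    · rintro ⟨c, hc, h⟩
      obtain rfl : b = c := by omega
      exact h

/-- The condition on the fractional part says that the largest power `2 ^ e ≤ q ^ (b + 1)` is even
smaller than `(q - 1) q ^ b`. -/
theorem log_lt_fract_iff {q b e : ℕ} (hq5 : 5 ≤ q) (h1 : 2 ^ e ≤ q ^ (b + 1))
    (h2 : q ^ (b + 1) < 2 ^ (e + 1)) :
    Real.log ((q : ℝ) / ((q : ℝ) - 1)) / Real.log 2 <
      Int.fract (((b + 1 : ℕ) : ℝ) * (Real.log q / Real.log 2)) ↔ 2 ^ e < (q - 1) * q ^ b := by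
  have hq0 : (5 : ℝ) ≤ q := by exact_mod_cast hq5
  have hlog2 : 0 < Real.log 2 := Real.log_pos (by norm_num)
  have h1' : (2 : ℝ) ^ e ≤ (q : ℝ) ^ (b + 1) := by exact_mod_cast h1
  have h2' : (q : ℝ) ^ (b + 1) < (2 : ℝ) ^ (e + 1) := by exact_mod_cast h2
  have hL : ((b + 1 : ℕ) : ℝ) * (Real.log q / Real.log 2) =
      Real.log ((q : ℝ) ^ (b + 1)) / Real.log 2 := by
    rw [Real.log_pow]
    ring
  have hfloor : ⌊Real.log ((q : ℝ) ^ (b + 1)) / Real.log 2⌋ = (e : ℤ) := by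
    rw [Int.floor_eq_iff]
    constructor
    · rw [le_div_iff₀ hlog2]
      have := Real.log_le_log (by positivity) h1'
      rw [Real.log_pow] at this
      exact_mod_cast this
    · rw [div_lt_iff₀ hlog2]
      have := Real.log_lt_log (by positivity) h2'
      rw [Real.log_pow 2] at this
      exact_mod_cast this
  have hcast : (((q - 1) * q ^ b : ℕ) : ℝ) = (q - 1) * q ^ b := by
    rw [Nat.cast_mul, Nat.cast_sub (by omega)]
    push_cast
    ring
  have hpos : 0 < ((q : ℝ) - 1) * q ^ b := mul_pos (by linarith) (by positivity)
  have hsplit : Real.log ((q : ℝ) ^ (b + 1)) =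
      Real.log ((q : ℝ) / ((q : ℝ) - 1)) + Real.log (((q : ℝ) - 1) * q ^ b) := by
    have hq1 : (q : ℝ) - 1 ≠ 0 := by linarith
    rw [← Real.log_mul (div_ne_zero (by linarith) hq1) hpos.ne']
    congr 1
    field_simp
    ring
  have hpow : (2 ^ e < (q - 1) * q ^ b) ↔
      Real.log ((2 : ℝ) ^ e) < Real.log (((q : ℝ) - 1) * q ^ b) := by
    rw [Real.log_lt_log_iff (by positivity) hpos, ← hcast]
    exact_mod_cast Iff.rfl
  rw [Int.fract, hL, hfloor, hpow, hsplit, Real.log_pow, add_div, ← sub_pos,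
    ← sub_pos (b := (e : ℝ) * Real.log 2)]
  have : Real.log ((q : ℝ) / ((q : ℝ) - 1)) / Real.log 2 +
      Real.log (((q : ℝ) - 1) * q ^ b) / Real.log 2 - ((e : ℤ) : ℝ) -
      Real.log ((q : ℝ) / ((q : ℝ) - 1)) / Real.log 2 =
      (Real.log (((q : ℝ) - 1) * q ^ b) - e * Real.log 2) / Real.log 2 := by
    push_cast
    field_simp
    ring
  rw [this]
  exact div_pos_iff_of_pos_right hlog2

theorem two_pow_mem_browkinValues {q : ℕ} (hq : Odd q) (e : ℕ) : 2 ^ e ∈ browkinValues q :=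
  ⟨2 ^ e, Nat.one_le_two_pow, le_antisymm (browkinD_le_two_pow hq le_rfl) (le_browkinD hq _)⟩

theorem even_pred_mul_pow {q : ℕ} (hq : Odd q) (b : ℕ) : Even ((q - 1) * q ^ b) := by
  obtain ⟨c, rfl⟩ := hq
  simp

theorem prime_pow_mem_browkinValues_iff {q b : ℕ} (hq : q.Prime) (hq5 : 5 ≤ q)
    (hA : IsArtinPrime q) (hM : IsMirimanoffPrime q → b = 0) :
    q ^ (b + 1) ∈ browkinValues q ↔ 2 ^ Nat.log 2 (q ^ (b + 1)) < (q - 1) * q ^ b := by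
  have hodd : Odd q := hq.odd_of_ne_two (by omega)
  have hne : q ^ (b + 1) ≠ 0 := pow_ne_zero _ hq.ne_zero
  have hlow := Nat.pow_log_le_self 2 hne
  have hup := Nat.lt_pow_succ_log_self (b := 2) (by norm_num) (q ^ (b + 1))
  constructor
  · rintro ⟨n, hn, hD⟩
    obtain ⟨-, hle, -, hlast⟩ := browkinD_eq_prime_pow hq hq5 hn hD
    refine lt_of_lt_of_le ?_ hle
    by_contra! hcon
    exact absurd (hlast _ hcon) (not_lt.2 hlow)
  · intro hlt
    have hpos : 1 ≤ (q - 1) * q ^ b := Nat.mul_pos (by omega) (pow_pos hq.pos b)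
    refine ⟨(q - 1) * q ^ b, hpos, le_antisymm (browkinD_le_prime_pow hq5 hA hM le_rfl) ?_⟩
    rcases browkinD_cases hq hq5 hpos with ⟨e, he, hle⟩ | ⟨c, hc, -, hle, -⟩ | ⟨-, h5, -, -⟩
    · have h1 : Nat.log 2 (q ^ (b + 1)) < e :=
        (Nat.pow_lt_pow_iff_right (a := 2) (by norm_num)).1 (hlt.trans_le hle)
      rw [he]
      exact hup.le.trans (Nat.pow_le_pow_right (by norm_num) h1)
    · have h1 : q ^ b ≤ q ^ c := Nat.le_of_mul_le_mul_left hle (by omega)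
      rw [hc, pow_succ, pow_succ]
      exact Nat.mul_le_mul_right q h1
    · have := even_pred_mul_pow hodd b
      rw [h5] at this
      exact absurd this (by decide)

theorem prime_mem_browkinValues {q : ℕ} (hq : q.Prime) (hq5 : 5 ≤ q) (hA : IsArtinPrime q)
    (hF : ¬ IsFermatPrime q) : q ∈ browkinValues q := by
  have hodd : Odd q := hq.odd_of_ne_two (by omega)
  have h := prime_pow_mem_browkinValues_iff (b := 0) hq hq5 hA (fun _ => rfl)
  rw [zero_add, pow_one, pow_zero, mul_one] at h
  rw [h]
  have hlow := Nat.pow_log_le_self 2 hq.ne_zero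
  have h1 : 2 ^ Nat.log 2 q ≠ q := by
    simpa using two_pow_ne_prime_pow hodd hq5 (Nat.log 2 q) 0
  have h2 : 2 ^ Nat.log 2 q ≠ q - 1 := by
    intro h
    exact hF ⟨hq, Nat.log 2 q, Nat.log_pos (by norm_num) (by omega), by omega⟩
  omega

theorem mainTheorem1 (q : ℕ) (hq : q.Prime) (hq5 : 5 ≤ q) :
    -- the exceptional case
    (((q : ℤ) ≡ 1 [ZMOD 28] ∨ (q : ℤ) ≡ -1 [ZMOD 28]) → browkinD q 5 = 7) ∧
    -- the four-case formula
    (∀ n : ℕ, 1 ≤ n →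
      ¬ (n = 5 ∧ ((q : ℤ) ≡ 1 [ZMOD 28] ∨ (q : ℤ) ≡ -1 [ZMOD 28])) →
      (IsArtinPrime q → ¬ IsMirimanoffPrime q →
        IsLeast ({m : ℕ | ∃ e : ℕ, m = 2 ^ e ∧ n ≤ 2 ^ e} ∪
          {m : ℕ | ∃ f : ℕ, m = q ^ f ∧ (q : ℝ) / ((q : ℝ) - 1) * (n : ℝ) ≤ (q : ℝ) ^ f})
          (browkinD q n)) ∧
      (IsArtinPrime q → IsMirimanoffPrime q → ¬ IsFermatPrime q →
        IsLeast ({m : ℕ | ∃ e : ℕ, m = 2 ^ e ∧ n ≤ 2 ^ e} ∪ {m : ℕ | m = q ∧ n + 1 ≤ q})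
          (browkinD q n)) ∧
      (IsArtinPrime q → IsMirimanoffPrime q → IsFermatPrime q →
        IsLeast {m : ℕ | ∃ e : ℕ, m = 2 ^ e ∧ n ≤ 2 ^ e} (browkinD q n)) ∧
      (¬ IsArtinPrime q →
        IsLeast {m : ℕ | ∃ e : ℕ, m = 2 ^ e ∧ n ≤ 2 ^ e} (browkinD q n))) ∧
    -- the powers of `2` and of `q` that occur as values
    (∀ e : ℕ, 2 ^ e ∈ browkinValues q) ∧
    (IsArtinPrime q → ¬ IsMirimanoffPrime q → ∀ f : ℕ, 1 ≤ f →
      (q ^ f ∈ browkinValues q ↔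
        Real.log ((q : ℝ) / ((q : ℝ) - 1)) / Real.log 2 <
          Int.fract ((f : ℝ) * (Real.log q / Real.log 2)))) ∧
    (IsArtinPrime q → IsMirimanoffPrime q → ¬ IsFermatPrime q → ∀ f : ℕ, 1 ≤ f →
      (q ^ f ∈ browkinValues q ↔ f = 1)) ∧
    (IsArtinPrime q → IsMirimanoffPrime q → IsFermatPrime q → ∀ f : ℕ, 1 ≤ f →
      q ^ f ∉ browkinValues q) ∧
    (¬ IsArtinPrime q → ∀ f : ℕ, 1 ≤ f → q ^ f ∉ browkinValues q) ∧
    -- Browkin's conjecture for `n ≠ 5`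
    (IsArtinPrime q → ∀ n : ℕ, 1 ≤ n → n ≠ 5 →
      (∃ e : ℕ, browkinD q n = 2 ^ e) ∨ (∃ f : ℕ, browkinD q n = q ^ f)) := by
  have hodd : Odd q := hq.odd_of_ne_two (by omega)
  have hiff := qStar_modEq_one_iff hodd
  refine ⟨fun h28 => ?_, fun n hn hexc => ?_, two_pow_mem_browkinValues hodd, ?_, ?_, ?_, ?_, ?_⟩
  · have h7 := discriminates_five_seven hodd (hiff.2 h28)
    refine le_antisymm ((browkinD_isLeast hodd 5).2 ⟨by norm_num, h7⟩) ?_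
    rcases browkinD_cases hq hq5 (n := 5) (by norm_num) with ⟨e, he, hle⟩ | ⟨b, hb, -⟩ | ⟨h, -⟩
    · rw [he]
      have : 2 < e := (Nat.pow_lt_pow_iff_right (a := 2) (by norm_num)).1 (by omega)
      calc 7 ≤ 2 ^ 3 := by norm_num
        _ ≤ 2 ^ e := Nat.pow_le_pow_right (by norm_num) this
    · rw [hb]
      have h1 : q ≤ q ^ (b + 1) := Nat.le_self_pow (by omega) q
      have h2 : 7 ≤ q := by
        unfold Int.ModEq at h28
        omega
      omega
    · exact h.ge
  · have hcases := browkinD_cases hq hq5 hn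
    have hno7 : ¬ (browkinD q n = 7 ∧ n = 5 ∧ q ≠ 7 ∧ qStar q ≡ 1 [ZMOD 7]) :=
      fun h => hexc ⟨h.2.1, hiff.1 h.2.2.2⟩
    have hlow2 : ∀ m ∈ {m : ℕ | ∃ e : ℕ, m = 2 ^ e ∧ n ≤ 2 ^ e}, browkinD q n ≤ m := by
      rintro m ⟨e, rfl, he⟩
      exact browkinD_le_two_pow hodd he
    refine ⟨fun hA hM => ⟨?_, ?_⟩, fun hA hM hF => ⟨?_, ?_⟩, fun hA hM hF => ⟨?_, hlow2⟩,
      fun hA => ⟨?_, hlow2⟩⟩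
    · rcases hcases with h | ⟨b, hb, -, hle, -⟩ | h
      · exact Or.inl h
      · exact Or.inr ⟨b + 1, hb, (div_mul_le_pow_iff hq5 hn).2 ⟨b, rfl, hle⟩⟩
      · exact absurd h hno7
    · rintro m (hm | ⟨f, rfl, hf⟩)
      · exact hlow2 m hm
      · obtain ⟨b, rfl, hle⟩ := (div_mul_le_pow_iff hq5 hn).1 hf
        exact browkinD_le_prime_pow hq5 hA (fun h => absurd h hM) hle
    · rcases hcases with h | ⟨b, hb, -, hle, h0⟩ | h
      · exact Or.inl h
      · rw [h0 hM, pow_zero, mul_one] at hle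
        rw [h0 hM, zero_add, pow_one] at hb
        exact Or.inr ⟨hb, by omega⟩
      · exact absurd h hno7
    · rintro m (hm | ⟨rfl, hle⟩)
      · exact hlow2 m hm
      · simpa using browkinD_le_prime_pow (b := 0) (n := n) hq5 hA (fun _ => rfl)
          (by rw [pow_zero, mul_one]; omega)
    · rcases hcases with h | ⟨b, hb, -, hle, h0⟩ | h
      · exact h
      · -- a Fermat prime `q = 2 ^ m + 1` is beaten by `2 ^ m = q - 1`
        obtain ⟨-, m, -, hm⟩ := hF
        obtain rfl := h0 hM
        have := (browkinD_eq_prime_pow hq hq5 hn hb).2.2.2 m (by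
          rw [pow_zero, mul_one] at hle
          omega)
        rw [zero_add, pow_one] at this
        omega
      · exact absurd h hno7
    · rcases hcases with h | ⟨b, -, hA', -⟩ | h
      · exact h
      · exact absurd hA' hA
      · exact absurd h hno7
  · intro hA hM f hf
    obtain ⟨b, rfl⟩ : ∃ b, f = b + 1 := ⟨f - 1, by omega⟩
    rw [prime_pow_mem_browkinValues_iff hq hq5 hA (fun h => absurd h hM), log_lt_fract_iff hq5
      (Nat.pow_log_le_self 2 (pow_ne_zero _ hq.ne_zero))
      (Nat.lt_pow_succ_log_self (by norm_num) _)]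
  · intro hA hM hF f hf
    constructor
    · rintro ⟨n, hn, hD⟩
      obtain ⟨b, rfl⟩ : ∃ b, f = b + 1 := ⟨f - 1, by omega⟩
      rw [(browkinD_eq_prime_pow hq hq5 hn hD).2.2.1 hM]
    · rintro rfl
      rw [pow_one]
      exact prime_mem_browkinValues hq hq5 hA hF
  · rintro hA hM ⟨-, m, -, hm⟩ f hf ⟨n, hn, hD⟩
    obtain ⟨b, rfl⟩ : ∃ b, f = b + 1 := ⟨f - 1, by omega⟩
    obtain ⟨-, hle, h0, hlast⟩ := browkinD_eq_prime_pow hq hq5 hn hD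
    obtain rfl := h0 hM
    rw [pow_zero, mul_one] at hle
    have := hlast m (by omega)
    rw [zero_add, pow_one] at this
    omega
  · rintro hA f hf ⟨n, hn, hD⟩
    obtain ⟨b, rfl⟩ : ∃ b, f = b + 1 := ⟨f - 1, by omega⟩
    exact hA (browkinD_eq_prime_pow hq hq5 hn hD).1
  · intro hA n hn hn5
    rcases browkinD_cases hq hq5 hn with ⟨e, he, -⟩ | ⟨b, hb, -⟩ | ⟨-, h5, -⟩
    · exact Or.inl ⟨e, he⟩
    · exact Or.inr ⟨b + 1, hb⟩
    · exact absurd h5 hn5
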